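/- Let $\Omega\subset\mathbb{R}^2$ be a bounded strictly convex domain with boundary $\Gamma$. For $x\in\overline\Omega$ and $\theta\in S^1$ let $\tau_\pm(x,\theta)$ be the distance from $x$ to $\Gamma$ in the direction $\pm\theta$ (the largest $t\ge 0$ with $x\pm t\theta\in\overline\Omega$), and $x^\pm_\theta=x\pm\tau_\pm(x,\theta)\theta\in\Gamma$. For a real function $a$ on $\overline\Omega$ put $Da(x,\theta)=\int_0^{\tau_+(x,\theta)}a(x+t\theta)\,dt$. A real function $g$ on $\Gamma\times S^1$ is called attenuated X-ray data of the real function $f$ (with attenuation $a$) if $$g(x^+_\theta,\theta)-e^{-Da(x^-_\theta,\theta)}g(x^-_\theta,\theta)=\int_{-\tau_-(x,\theta)}^{\tau_+(x,\theta)}f(x+t\theta)\,e^{-Da(x+t\theta,\theta)}\,dt\qquad\text{for all }(x,\theta)\in\overline\Omega\times S^1,$$ and attenuated Doppler data of the real vector field $\mathbf F$ if the same holds with $\theta\cdot\mathbf F$ in place of $f$. The integrals over the chord are understood as improper integrals at its two endpoints (ordinary integrals whenever the integrand is integrable along the chord), and are $0$ on degenerate chords. Let $C^{1,\alpha}_0(\overline\Omega)$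 be the space of functions that are $C^1$ in $\Omega$, continuous on $\overline\Omega$, with $\alpha$-Hölder continuous gradient in $\Omega$, and that vanish on $\Gamma$. (i) Let $a,f\in C^1(\Omega)\cap C(\overline\Omega)$ be real valued with $a>0$ in $\Omega$, and suppose that $f/a$ vanishes on $\Gamma$, i.e. $f(x)/a(x)\to 0$ as $\Omega\ni x\to\zeta$ for every $\zeta\in\Gamma$. Then the vector field $\mathbf F:=-\nabla(f/a)$ has the same attenuated Doppler data as the attenuated X-ray data of $f$: attenuated X-ray data of $f$ exist, and a function $g$ on $\Gamma\times S^1$ is attenuated Doppler data of $\mathbf F$ if and only if it is attenuated X-ray data of $f$. (ii) Conversely, let $1/2<\alpha<1$, let $a\in C^{1,\alpha}_0(\overline\Omega)$ be real valued with $a>0$ in $\Omega$, and let $\mathbf F\in C^{1,\alpha}_0(\overline\Omega;\mathbb{R}^2)$ and $f\in C^{1,\alpha}_0(\overline\Omega)$ be real valued. If some function $g$ on $\Gamma\times S^1$ is both attenuated Doppler data of $\mathbf F$ and attenuated X-ray data of $f$, then $\mathbf F$ is a gradient field in $\Omega$ and $\mathbf F=-\nabla(f/a)$ in $\Omega$.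 -/

import Mathlib

open Set Filter Topology

noncomputable section

/-- The Euclidean plane. -/
abbrev Plane : Type := EuclideanSpace ℝ (Fin 2)

/-- `exitDist Ω x θ` is the distance `τ₊(x, θ)` from `x ∈ closure Ω` to the boundary of the
bounded convex set `Ω` in the direction `θ`; it is `0` if the ray leaves `closure Ω` at once.
The distance in the direction `-θ` is `τ₋(x, θ) = exitDist Ω x (-θ)`. -/
def exitDist (Ω : Set Plane) (x θ : Plane) : ℝ :=
  sSup {t : ℝ | 0 ≤ t ∧ x + t • θ ∈ closure Ω}

/-- The exit point `x⁺ = x + τ₊ θ` of the chord through `x` in the direction `θ`. -/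
def exitPoint (Ω : Set Plane) (x θ : Plane) : Plane :=
  x + exitDist Ω x θ • θ

/-- The entry point `x⁻ = x - τ₋ θ` of the chord through `x` in the direction `θ`. -/
def entryPoint (Ω : Set Plane) (x θ : Plane) : Plane :=
  x - exitDist Ω x (-θ) • θ

/-- The divergence beam transform of `a`: the integral of `a` from `x` to the boundary in the
direction `θ`. -/
def beam (Ω : Set Plane) (a : Plane → ℝ) (x θ : Plane) : ℝ :=
  ∫ t in (0 : ℝ)..exitDist Ω x θ, a (x + t • θ)

/-- `HasChordIntegral Ω q x θ I` says that the integral of `q` over the part inside `Ω` of the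
chord through `x` in the direction `θ`, that is `∫ q (x + t θ) dt` over `-τ₋ < t < τ₊`,
exists and has the value `I`.  It is an improper integral at the two endpoints: `q` is integrable
on compact pieces of the open chord, and the integrals over these pieces converge to `I`.
This is the ordinary integral whenever `q` is integrable along the chord.
On a degenerate chord (`x` on the boundary, `θ` tangential) it says `I = 0`. -/
def HasChordIntegral (Ω : Set Plane) (q : Plane → ℝ) (x θ : Plane) (I : ℝ) : Prop :=
  (∀ r ∈ Ioo (-exitDist Ω x (-θ)) (exitDist Ω x θ),
    ∀ s ∈ Ioo (-exitDist Ω x (-θ)) (exitDist Ω x θ),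
      IntervalIntegrable (fun t : ℝ => Ω.indicator q (x + t • θ)) MeasureTheory.volume r s) ∧
  Tendsto (fun p : ℝ × ℝ => ∫ t in p.1..p.2, Ω.indicator q (x + t • θ))
    (𝓝[>] (-exitDist Ω x (-θ)) ×ˢ 𝓝[<] (exitDist Ω x θ)) (𝓝 I)

/-- `g`, a function of `(ζ, θ)` with `ζ` on the boundary of `Ω` and `θ` a unit vector, is an
attenuated X-ray transform of the function `f` with attenuation `a`. -/
def IsXRayData (Ω : Set Plane) (a f : Plane → ℝ) (g : Plane → Plane → ℝ) : Prop :=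
  ∀ x ∈ closure Ω, ∀ θ : Plane, ‖θ‖ = 1 →
    HasChordIntegral Ω (fun y => f y * Real.exp (-beam Ω a y θ)) x θ
      (g (exitPoint Ω x θ) θ -
        Real.exp (-beam Ω a (entryPoint Ω x θ) θ) * g (entryPoint Ω x θ) θ)

/-- `g`, a function of `(ζ, θ)` with `ζ` on the boundary of `Ω` and `θ` a unit vector, is an
attenuated Doppler transform of the vector field `F` with attenuation `a`. -/
def IsDopplerData (Ω : Set Plane) (a : Plane → ℝ) (F : Plane → Plane)
    (g : Plane → Plane → ℝ) : Prop :=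
  ∀ x ∈ closure Ω, ∀ θ : Plane, ‖θ‖ = 1 →
    HasChordIntegral Ω (fun y => inner ℝ θ (F y) * Real.exp (-beam Ω a y θ)) x θ
      (g (exitPoint Ω x θ) θ -
        Real.exp (-beam Ω a (entryPoint Ω x θ) θ) * g (entryPoint Ω x θ) θ)

/-- The class of functions that are `C^{1,α}` up to the boundary of `Ω` and vanish on the
boundary.  For bounded convex `Ω`, Hölder continuity of the derivative on `Ω` includes its
boundedness and its continuous extension to the closure. -/
def MemC1HolderZero (Ω : Set Plane) (α : NNReal) {V : Type*} [NormedAddCommGroup V]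
    [NormedSpace ℝ V] (u : Plane → V) : Prop :=
  ContDiffOn ℝ 1 u Ω ∧ ContinuousOn u (closure Ω) ∧
    (∃ C : NNReal, HolderOnWith C α (fderiv ℝ u) Ω) ∧ ∀ x ∈ frontier Ω, u x = 0

end

/-!
A function `f` and the field `F = -∇u`, `u = f / a`, have the same data because along a chord
`f exp (-beam) - θ · F exp (-beam)` is the derivative of `u exp (-beam)`, and `u` vanishes at the
end points (`isDopplerData_iff_isXRayData`).

For the converse, `f` and `F` have common data exactly if the attenuated integrals of `f - θ · F`
vanish along all lines. Identify the plane with `ℂ`, extend `a`, `f`, `F` by zero (the extension of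
`a` is Lipschitz, and no more regularity is used), and let `u(z, l)` be the solution of
`l · ∇u + a u = f - l · F` that vanishes at the beginning of every line; its support is compact
because the data vanish. It suffices to show that `u` does not depend on the direction `l`: then
`u(z, l) = p(z)`, and the even and odd parts in `l` of the equation are `a p = f` and `∇p = -F`
(`exists_potential`).

Independence of `l` follows from a holomorphic integrating factor. There is a function `w(z, l)`,
`holFactor`, with `l · ∇w = a`, which for fixed `z` is the boundary value of the bounded holomorphic
function `discFactor` on the unit disc `|μ| < 1`. Its kernel `μ / (π (y - μ² conj y))` is the
fundamental solution of `μ ∂ + μ⁻¹ ∂̄`; as `|μ| → 1`, its real part concentrates on the line of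
direction `l`, and its imaginary part yields the Hilbert transform of the Radon transform of `a`,
which is constant along the lines of direction `l`
(`tendsto_integral_mul_inv_sub_sq_mul_conj`, `exists_norm_discFactor_le_and_tendsto`).
The function `v = exp w * u` satisfies `l · ∇v = exp w * (f - l · F)`. As `exp w` has no Fourier
modes in `l` of negative index, the right-hand side has none of index below `-1`
(`integral_mul_boundaryValue_eq_zero`), and the Fourier transform in `z` shows that `v` has no modes
of negative index at all (`integral_mul_exp_pow_eq_zero_of_hasLineDerivAt`). Neither has
`u = exp (-w) * v`, and since `u` is real, it is constant in `l`.
-/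

noncomputable section

/-! ### Fourier coefficients on the circle -/

open Complex MeasureTheory in
/-- Multiplication by the boundary values `Γ` of a bounded holomorphic function on the unit disc
preserves the vanishing of all Fourier coefficients of index at most `-N`: on the circle of
radius `r < 1` this is read off from the power series, and then `r` tends to `1`. -/
lemma integral_mul_boundaryValue_eq_zero {G : ℂ → ℂ} (hG : DifferentiableOn ℂ G (Metric.ball 0 1))
    {Γ : ℝ → ℂ} {C : ℝ} (hC : ∀ μ ∈ Metric.ball (0 : ℂ) 1, ‖G μ‖ ≤ C)
    (hlim : ∀ φ : ℝ, Tendsto (fun r : ℝ => G (r * exp (φ * I))) (𝓝[<] 1) (𝓝 (Γ φ)))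
    {g : ℝ → ℂ} (hg : Continuous g) {N : ℕ}
    (h : ∀ n ≥ N, ∫ φ in (0 : ℝ)..2 * Real.pi, g φ * exp (φ * I) ^ n = 0) :
    ∀ n ≥ N, ∫ φ in (0 : ℝ)..2 * Real.pi, Γ φ * g φ * exp (φ * I) ^ n = 0 := by
  intro n hn
  have hmem : ∀ r : ℝ, r ∈ Ioo (0 : ℝ) 1 → ∀ φ : ℝ,
      (r * exp (φ * I) : ℂ) ∈ Metric.ball (0 : ℂ) 1 := by
    intro r hr φ
    simp [Complex.norm_exp_ofReal_mul_I, abs_of_pos hr.1, hr.2]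
  have hev : ∀ᶠ r : ℝ in 𝓝[<] 1, r ∈ Ioo (0 : ℝ) 1 := Ioo_mem_nhdsLT one_pos
  have hcont : ∀ r ∈ Ioo (0 : ℝ) 1, Continuous fun φ : ℝ => G (r * exp (φ * I)) := by
    intro r hr
    exact hG.continuousOn.comp_continuous (by fun_prop) (hmem r hr)
  have hzero : ∀ r ∈ Ioo (0 : ℝ) 1,
      ∫ φ in (0 : ℝ)..2 * Real.pi, G (r * exp (φ * I)) * g φ * exp (φ * I) ^ n = 0 := by
    intro r hr
    set t : ℕ → ℂ := fun k => ((k.factorial : ℂ)⁻¹ * iteratedDeriv k G 0) with ht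
    have hsum : ∀ z ∈ Metric.ball (0 : ℂ) 1, HasSum (fun k => t k * z ^ k) (G z) := by
      intro z hz
      have := Complex.hasSum_taylorSeries_on_ball hG hz
      refine this.congr_fun ?_
      intro k
      simp [ht, smul_eq_mul]; ring
    have hrs : Summable fun k => ‖t k * (r : ℂ) ^ k‖ := by
      have h1 : (r : ℂ) ∈ Metric.ball (0 : ℂ) 1 := by simpa using hmem r hr 0
      exact (hsum r h1).summable.norm
    obtain ⟨K, hK⟩ := (isCompact_Icc (a := (0 : ℝ)) (b := 2 * Real.pi)).exists_bound_of_continuousOn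
      hg.continuousOn
    have := intervalIntegral.hasSum_integral_of_dominated_convergence (μ := volume)
      (a := (0 : ℝ)) (b := 2 * Real.pi)
      (F := fun k φ => t k * (r * exp (φ * I)) ^ k * (g φ * exp (φ * I) ^ n))
      (f := fun φ => G (r * exp (φ * I)) * (g φ * exp (φ * I) ^ n))
      (fun k _ => ‖t k * (r : ℂ) ^ k‖ * K)
      (fun k => (by fun_prop : Continuous _).aestronglyMeasurable)
      (fun k => Eventually.of_forall fun φ hφ => by
        rw [uIoc_of_le (by positivity)] at hφ
        have := hK φ ⟨hφ.1.le, hφ.2⟩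
        simp only [norm_mul, norm_pow, Complex.norm_exp_ofReal_mul_I, mul_one, one_pow]
        gcongr)
      (Eventually.of_forall fun φ _ => hrs.mul_right K)
      (by simp)
      (Eventually.of_forall fun φ _ => (hsum _ (hmem r hr φ)).mul_right _)
    have hz : ∀ k, ∫ φ in (0 : ℝ)..2 * Real.pi,
        t k * (r * exp (φ * I)) ^ k * (g φ * exp (φ * I) ^ n) = 0 := by
      intro k
      have h2 := h (n + k) (by omega)
      rw [← mul_zero (t k * (r : ℂ) ^ k), ← h2, ← intervalIntegral.integral_const_mul]
      congr 1; ext φ; ring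
    simp only [hz] at this
    simpa [mul_assoc] using (this.unique hasSum_zero)
  obtain ⟨K, hK⟩ := (isCompact_Icc (a := (0 : ℝ)) (b := 2 * Real.pi)).exists_bound_of_continuousOn
      hg.continuousOn
  have htend : Tendsto (fun r : ℝ => ∫ φ in (0 : ℝ)..2 * Real.pi,
      G (r * exp (φ * I)) * g φ * exp (φ * I) ^ n) (𝓝[<] 1)
      (𝓝 (∫ φ in (0 : ℝ)..2 * Real.pi, Γ φ * g φ * exp (φ * I) ^ n)) := by
    refine intervalIntegral.tendsto_integral_filter_of_dominated_convergence (fun _ => C * K)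
      ?_ ?_ (by simp) ?_
    · filter_upwards [hev] with r hr
      exact (((hcont r hr).mul hg).mul (by fun_prop)).aestronglyMeasurable
    · filter_upwards [hev] with r hr
      refine Eventually.of_forall fun φ hφ => ?_
      rw [uIoc_of_le (by positivity)] at hφ
      have h1 := hK φ ⟨hφ.1.le, hφ.2⟩
      have h2 := hC _ (hmem r hr φ)
      simp only [norm_mul, norm_pow, Complex.norm_exp_ofReal_mul_I, mul_one, one_pow]
      have := (norm_nonneg _).trans h2
      gcongr
    · exact Eventually.of_forall fun φ _ => ((hlim φ).mul_const _).mul_const _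
  refine tendsto_nhds_unique htend ?_
  refine tendsto_const_nhds.congr' ?_
  filter_upwards [hev] with r hr
  exact (hzero r hr).symm

open Complex in
/-- A real function on the circle without Fourier coefficients of negative index is constant,
since its other coefficients are their conjugates. -/
lemma eq_of_integral_mul_exp_pow_eq_zero {u : ℝ → ℝ} (hu : Continuous u)
    (hper : Function.Periodic u (2 * Real.pi))
    (h : ∀ n : ℕ, 1 ≤ n → ∫ φ in (0 : ℝ)..2 * Real.pi, (u φ : ℂ) * exp (φ * I) ^ n = 0) (φ ψ : ℝ) :
    u φ = u ψ := by
  have : Fact (0 < 2 * Real.pi) := ⟨by positivity⟩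
  have hper' : Function.Periodic (fun φ => (u φ : ℂ)) (2 * Real.pi) := fun x => by simp [hper x]
  let U : C(AddCircle (2 * Real.pi), ℂ) := ⟨hper'.lift, by
    refine continuous_coinduced_dom.2 ?_
    have : Continuous (fun φ => (u φ : ℂ)) := by fun_prop
    exact this⟩
  have hU : ∀ x : ℝ, U (x : AddCircle (2 * Real.pi)) = u x := fun x => rfl
  have hneg : ∀ n : ℕ, 1 ≤ n → fourierCoeff U (-(n : ℤ)) = 0 := by
    intro n hn
    rw [fourierCoeff_eq_intervalIntegral _ _ 0]
    have := h n hn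
    rw [zero_add]
    convert smul_zero _ using 2
    rw [← this]
    congr 1; ext x
    rw [hU, smul_eq_mul, mul_comm, fourier_coe_apply, ← Complex.exp_nat_mul]
    congr 2
    push_cast
    field_simp
  have hpos : ∀ n : ℕ, 1 ≤ n → fourierCoeff U (n : ℤ) = 0 := by
    intro n hn
    have h1 := hneg n hn
    have : fourierCoeff U (n : ℤ) = (starRingEnd ℂ) (fourierCoeff U (-(n : ℤ))) := by
      rw [fourierCoeff_eq_intervalIntegral _ _ 0, fourierCoeff_eq_intervalIntegral _ _ 0]
      rw [Complex.real_smul, Complex.real_smul, map_mul, Complex.conj_ofReal]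
      congr 1
      rw [zero_add, intervalIntegral.integral_of_le (by positivity),
        intervalIntegral.integral_of_le (by positivity), ← integral_conj]
      congr 1; ext x
      simp only [hU, smul_eq_mul, map_mul, Complex.conj_ofReal]
      rw [neg_neg, ← fourier_neg]
    rw [this, h1, map_zero]
  have hne : ∀ n : ℤ, n ≠ 0 → fourierCoeff U n = 0 := by
    intro n hn
    rcases lt_or_gt_of_ne hn with h1 | h1
    · have := hneg n.natAbs (by omega)
      rwa [show -(n.natAbs : ℤ) = n by omega] at this
    · have := hpos n.natAbs (by omega)
      rwa [show (n.natAbs : ℤ) = n by omega] at this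
  have hs : Summable (fourierCoeff U) := summable_of_ne_finset_zero (s := {0}) (by
    intro n hn; exact hne n (by simpa using hn))
  have key : ∀ x : ℝ, (u x : ℂ) = fourierCoeff U 0 := by
    intro x
    have h1 := has_pointwise_sum_fourier_series_of_summable hs (x : AddCircle (2 * Real.pi))
    have h2 := hasSum_single
      (f := fun i => fourierCoeff U i • fourier i (x : AddCircle (2 * Real.pi))) 0 (by
      intro n hn; simp [hne n hn])
    have := h1.unique h2
    rw [hU] at this
    simpa using this
  exact_mod_cast (key φ).trans (key ψ).symm

open Complex MeasureTheory in
/-- The Riemann-Lebesgue lemma on the circle. -/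
lemma tendsto_integral_mul_exp_pow {g : ℝ → ℂ} :
    Tendsto (fun n : ℕ => ∫ φ in (0 : ℝ)..2 * Real.pi, g φ * exp (φ * I) ^ n) atTop (𝓝 0) := by
  have h := Real.tendsto_integral_exp_smul_cocompact (indicator (Ioc 0 (2 * Real.pi)) g)
  have h2 : Tendsto (fun n : ℕ => -((n : ℝ) / (2 * Real.pi))) atTop (cocompact ℝ) := by
    refine (tendsto_neg_atTop_atBot.comp (tendsto_natCast_atTop_atTop.atTop_div_const
      (by positivity))).mono_right ?_
    rw [cocompact_eq_atBot_atTop]; exact le_sup_left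
  refine (h.comp h2).congr fun n => ?_
  rw [intervalIntegral.integral_of_le (by positivity), ← integral_indicator measurableSet_Ioc]
  simp only [Function.comp]
  congr 1; ext x
  by_cases hx : x ∈ Ioc 0 (2 * Real.pi)
  · simp only [indicator_of_mem hx, Circle.smul_def, Real.fourierChar_apply, smul_eq_mul]
    rw [mul_comm, ← Complex.exp_nat_mul]
    congr 2
    push_cast
    field_simp
  · simp [indicator_of_notMem hx]

lemma eq_zero_of_norm_add_two_eq {c : ℕ → ℂ} (h : ∀ n, 1 ≤ n → ‖c (n + 2)‖ = ‖c n‖)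
    (hc : Tendsto c atTop (𝓝 0)) {n : ℕ} (hn : 1 ≤ n) : c n = 0 := by
  have h1 : ∀ k, ‖c (n + 2 * k)‖ = ‖c n‖ := by
    intro k
    induction k with
    | zero => rfl
    | succ k ih => rw [← ih, ← h (n + 2 * k) (by omega)]; rfl
  have h2 : Tendsto (fun k => ‖c (n + 2 * k)‖) atTop (𝓝 0) := by
    have := (hc.comp (tendsto_atTop_mono (fun k => (by omega : k ≤ n + 2 * k)) tendsto_id)).norm
    simpa using this
  simp only [h1] at h2
  simpa using tendsto_nhds_unique tendsto_const_nhds h2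

/-! ### The limit of the kernel at the unit circle -/

open MeasureTheory in
lemma integrable_indicator_closedBall {E : Type*} [NormedAddCommGroup E] [MeasurableSpace E]
    [BorelSpace E] [ProperSpace E] (μ : Measure E) [IsFiniteMeasureOnCompacts μ] (S C : ℝ) :
    Integrable ((Metric.closedBall (0 : E) S).indicator fun _ => C) μ :=
  (integrableOn_const (isCompact_closedBall (0 : E) S).measure_lt_top.ne).integrable_indicator
    Metric.isClosed_closedBall.measurableSet

lemma norm_le_indicator_closedBall {E F : Type*} [NormedAddCommGroup E] [NormedAddCommGroup F]
    {f : E → F} {S C : ℝ} (hC : ∀ y, ‖f y‖ ≤ C) (hS : ∀ y, S ≤ ‖y‖ → f y = 0) (y : E) :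
    ‖f y‖ ≤ (Metric.closedBall (0 : E) S).indicator (fun _ => C) y := by
  by_cases hy : y ∈ Metric.closedBall (0 : E) S
  · rw [indicator_of_mem hy]; exact hC y
  · rw [indicator_of_notMem hy, hS y (by simpa using (lt_of_not_ge (by simpa using hy)).le),
      norm_zero]

open MeasureTheory in
lemma integrable_of_norm_le_of_eq_zero {E F : Type*} [NormedAddCommGroup E] [MeasurableSpace E]
    [BorelSpace E] [ProperSpace E] {μ : Measure E} [IsFiniteMeasureOnCompacts μ]
    [NormedAddCommGroup F] {f : E → F} {S C : ℝ} (hf : AEStronglyMeasurable f μ)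
    (hC : ∀ y, ‖f y‖ ≤ C) (hS : ∀ y, S ≤ ‖y‖ → f y = 0) : Integrable f μ :=
  (integrable_indicator_closedBall μ S C).mono' hf
    (Eventually.of_forall (norm_le_indicator_closedBall hC hS))

lemma measurable_realSign : Measurable Real.sign := by
  unfold Real.sign
  exact Measurable.ite measurableSet_Iio measurable_const
    (Measurable.ite measurableSet_Ioi measurable_const measurable_const)

lemma abs_realSign_le_one (t : ℝ) : |Real.sign t| ≤ 1 := by
  rcases Real.sign_apply_eq t with h | h | h <;> simp [h]

section kernel

open MeasureTheory Complex ComplexConjugate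

variable {D : ℂ → ℝ} {K S B : ℝ}

lemma sub_sq_mul_conj_eq (r : ℝ) (y : ℂ) :
    y - (r : ℂ) ^ 2 * conj y = ⟨(1 - r ^ 2) * y.re, (1 + r ^ 2) * y.im⟩ := by
  apply Complex.ext <;> simp [pow_two] <;> ring

lemma norm_sub_sq_mul_conj_ge {μ : ℂ} (y : ℂ) :
    (1 - ‖μ‖ ^ 2) * ‖y‖ ≤ ‖y - μ ^ 2 * conj y‖ := by
  have := norm_sub_norm_le y (μ ^ 2 * conj y)
  simp only [norm_mul, norm_pow, Complex.norm_conj] at this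
  linarith

lemma integrable_mul_inv_sub_sq_mul_conj (hDm : Continuous D) (hK : ∀ y, |D y| ≤ K * ‖y‖)
    (hS : ∀ y, S ≤ ‖y‖ → D y = 0) {μ : ℂ} (hμ : ‖μ‖ < 1) :
    Integrable fun y : ℂ => (D y : ℂ) * (y - μ ^ 2 * conj y)⁻¹ := by
  have h1 : 0 < 1 - ‖μ‖ ^ 2 := by nlinarith [norm_nonneg μ]
  refine integrable_of_norm_le_of_eq_zero (S := S) (C := K / (1 - ‖μ‖ ^ 2))
    (Measurable.aestronglyMeasurable (by fun_prop)) ?_ ?_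
  · intro y
    have hK0 : 0 ≤ K := by simpa using (abs_nonneg _).trans (hK 1)
    rw [norm_mul, norm_inv, Complex.norm_real, Real.norm_eq_abs, ← div_eq_mul_inv]
    rcases eq_or_ne y 0 with rfl | hy
    · simp; positivity
    have hy' : 0 < ‖y‖ := norm_pos_iff.2 hy
    have h2 := norm_sub_sq_mul_conj_ge (μ := μ) y
    calc |D y| / ‖y - μ ^ 2 * conj y‖ ≤ (K * ‖y‖) / ((1 - ‖μ‖ ^ 2) * ‖y‖) := by
          gcongr; exact hK y
      _ = K / (1 - ‖μ‖ ^ 2) := by field_simp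
  · intro y hy; simp [hS y hy]

/-- The average of `D` over the vertical line through `t`, with the Cauchy weight
`(1 + σ²)⁻¹` spread at scale `ε t`. -/
def lineAverage (D : ℂ → ℝ) (ε t : ℝ) : ℝ := ∫ σ : ℝ, D ⟨t, ε * t * σ⟩ * (1 + σ ^ 2)⁻¹

lemma lineAverage_abs_le (hB : ∀ y, |D y| ≤ B) (hS : ∀ y, S ≤ ‖y‖ → D y = 0) (ε t : ℝ) :
    |lineAverage D ε t| ≤ (Metric.closedBall (0 : ℝ) S).indicator (fun _ => B * Real.pi) t := by
  refine norm_le_indicator_closedBall (f := lineAverage D ε) (fun t => ?_) (fun t ht => ?_) t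
  · rw [← integral_univ_inv_one_add_sq, ← integral_const_mul]
    refine norm_integral_le_of_norm_le (integrable_inv_one_add_sq.const_mul B)
      (Eventually.of_forall fun σ => ?_)
    have : 0 < (1 + σ ^ 2)⁻¹ := by positivity
    rw [norm_mul, Real.norm_eq_abs, Real.norm_eq_abs, abs_of_pos this]
    gcongr; exact hB _
  · rw [lineAverage]
    have : ∀ σ : ℝ, D ⟨t, ε * t * σ⟩ = 0 := fun σ =>
      hS _ (ht.trans (abs_re_le_norm (⟨t, ε * t * σ⟩ : ℂ)))
    simp [this]

/-- `t ↦ D t` is the restriction of `D` to the real line; the weight `(1 + σ²)⁻¹` has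
integral `π`. -/
lemma tendsto_lineAverage (hDm : Continuous D) (hB : ∀ y, |D y| ≤ B) (t : ℝ) :
    Tendsto (fun ε => lineAverage D ε t) (𝓝 0) (𝓝 (Real.pi * D t)) := by
  have : Real.pi * D t = ∫ σ : ℝ, D ⟨t, 0 * t * σ⟩ * (1 + σ ^ 2)⁻¹ := by
    rw [← integral_univ_inv_one_add_sq, mul_comm, ← integral_const_mul]
    congr 1; ext σ
    congr 2; apply Complex.ext <;> simp
  rw [this]
  have hc : ∀ σ : ℝ, Continuous fun ε : ℝ => D ⟨t, ε * t * σ⟩ := fun σ =>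
    hDm.comp (by simp only [Complex.mk_eq_add_mul_I]; fun_prop)
  refine tendsto_integral_filter_of_dominated_convergence (fun σ => B * (1 + σ ^ 2)⁻¹)
    (Eventually.of_forall fun ε => ?_)
    (Eventually.of_forall fun ε => Eventually.of_forall fun σ => ?_)
    (integrable_inv_one_add_sq.const_mul B) (Eventually.of_forall fun σ => ?_)
  · have : Continuous fun σ : ℝ => D ⟨t, ε * t * σ⟩ :=
      hDm.comp (by simp only [Complex.mk_eq_add_mul_I]; fun_prop)
    exact (this.measurable.mul (by fun_prop)).aestronglyMeasurable
  · have : 0 < (1 + σ ^ 2)⁻¹ := by positivity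
    rw [norm_mul, Real.norm_eq_abs, Real.norm_eq_abs, abs_of_pos this]
    gcongr; exact hB _
  · exact ((hc σ).tendsto 0).mul_const _

/-- The real part of the kernel is a Poisson kernel in the imaginary variable: with `t = re y` and
the substitution `im y = ε t σ`, `ε = (1 - r²) / (1 + r²)`, it turns into a Cauchy weight. -/
lemma integral_re_kernel (hDm : Continuous D) (hK : ∀ y, |D y| ≤ K * ‖y‖)
    (hS : ∀ y, S ≤ ‖y‖ → D y = 0) {r : ℝ} (hr : r ∈ Ioo (0 : ℝ) 1) :
    ∫ y : ℂ, ((D y : ℂ) * (y - (r : ℂ) ^ 2 * conj y)⁻¹).re =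
      (1 + r ^ 2)⁻¹ * ∫ t : ℝ, Real.sign t * lineAverage D ((1 - r ^ 2) / (1 + r ^ 2)) t := by
  have hint := (integrable_mul_inv_sub_sq_mul_conj hDm hK hS (μ := r)
    (by simpa [abs_of_pos hr.1] using hr.2)).re
  have hc : 0 < 1 - r ^ 2 := by nlinarith [hr.1, hr.2]
  have hd : 0 < 1 + r ^ 2 := by positivity
  rw [← (Complex.volume_preserving_equiv_real_prod.symm).integral_comp
    (Complex.measurableEquivRealProd.symm.measurableEmbedding)]
  rw [Measure.volume_eq_prod, integral_prod]
  · rw [← integral_const_mul]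
    refine integral_congr_ae ?_
    filter_upwards [compl_mem_ae_iff.2 (measure_singleton (μ := volume) (0 : ℝ))] with t ht
    have ht : t ≠ 0 := ht
    set ε := (1 - r ^ 2) / (1 + r ^ 2) with hε
    have hε0 : 0 < ε := by positivity
    have := Measure.integral_comp_mul_left (fun s : ℝ =>
      ((D ⟨t, s⟩ : ℂ) * ((⟨t, s⟩ : ℂ) - (r : ℂ) ^ 2 * conj (⟨t, s⟩ : ℂ))⁻¹).re) (ε * t)
    have h2 : ∫ s : ℝ, ((D ⟨t, s⟩ : ℂ) * ((⟨t, s⟩ : ℂ) - (r : ℂ) ^ 2 * conj (⟨t, s⟩ : ℂ))⁻¹).re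
        = |ε * t| * ∫ σ : ℝ, ((D ⟨t, ε * t * σ⟩ : ℂ) *
          ((⟨t, ε * t * σ⟩ : ℂ) - (r : ℂ) ^ 2 * conj (⟨t, ε * t * σ⟩ : ℂ))⁻¹).re := by
      rw [this, smul_eq_mul, ← mul_assoc, abs_inv, mul_inv_cancel₀, one_mul]
      positivity
    simp only [Complex.measurableEquivRealProd_symm_apply]
    rw [h2, lineAverage, ← integral_const_mul, ← integral_const_mul, ← integral_const_mul]
    congr 1; ext σ
    rw [sub_sq_mul_conj_eq, Complex.re_ofReal_mul, Complex.inv_re, Complex.normSq_mk]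
    have hs : |t| = Real.sign t * t := by
      rcases lt_or_gt_of_ne ht with h | h
      · rw [abs_of_neg h, Real.sign_of_neg h]; ring
      · rw [abs_of_pos h, Real.sign_of_pos h]; ring
    rw [abs_mul, abs_of_pos hε0, hs]
    have : (1 + r ^ 2) * (ε * t * σ) = (1 - r ^ 2) * t * σ := by rw [hε]; field_simp
    simp only [this]
    rw [hε]
    have h3 : (1 - r ^ 2) * t * ((1 - r ^ 2) * t) + (1 - r ^ 2) * t * σ * ((1 - r ^ 2) * t * σ)
      = ((1 - r ^ 2) * t) ^ 2 * (1 + σ ^ 2) := by ring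
    rw [h3]
    have h4 : 0 < 1 + σ ^ 2 := by positivity
    field_simp
  · rw [← Measure.volume_eq_prod]
    exact (Complex.volume_preserving_equiv_real_prod.symm).integrable_comp_emb
      (Complex.measurableEquivRealProd.symm.measurableEmbedding) |>.2 hint

lemma integral_comp_conj {E : Type*} [NormedAddCommGroup E] [NormedSpace ℝ E] (f : ℂ → E) :
    ∫ y, f (conj y) = ∫ y, f y :=
  (Complex.conjLIE.measurePreserving).integral_comp
    Complex.conjLIE.toHomeomorph.measurableEmbedding f

/-- The imaginary part of the kernel is odd under conjugation, so only the difference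
`D y - D (conj y)`, which is small near the real axis, contributes. -/
lemma integral_im_kernel (hDm : Continuous D) (hK : ∀ y, |D y| ≤ K * ‖y‖)
    (hS : ∀ y, S ≤ ‖y‖ → D y = 0) {r : ℝ} (hr : r ∈ Ioo (0 : ℝ) 1) :
    ∫ y : ℂ, ((D y : ℂ) * (y - (r : ℂ) ^ 2 * conj y)⁻¹).im =
      - ∫ y : ℂ, (D y - D (conj y)) / 2 * ((1 + r ^ 2) * y.im /
        (((1 - r ^ 2) * y.re) ^ 2 + ((1 + r ^ 2) * y.im) ^ 2)) := by
  have hint : Integrable fun y : ℂ => ((D y : ℂ) * (y - (r : ℂ) ^ 2 * conj y)⁻¹).im :=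
    (integrable_mul_inv_sub_sq_mul_conj hDm hK hS (μ := r)
    (by simpa [abs_of_pos hr.1] using hr.2)).im
  have hint2 : Integrable fun y : ℂ => ((D (conj y) : ℂ) *
      (conj y - (r : ℂ) ^ 2 * conj (conj y))⁻¹).im :=
    (Complex.conjLIE.measurePreserving.integrable_comp_emb
      Complex.conjLIE.toHomeomorph.measurableEmbedding).2 hint
  have h1 := integral_comp_conj fun y : ℂ => ((D y : ℂ) * (y - (r : ℂ) ^ 2 * conj y)⁻¹).im
  have h2 := integral_add hint hint2
  rw [h1] at h2
  have h3 : ∀ X Y : ℝ, Y = X + X → X = Y / 2 := by intros; linarith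
  rw [h3 _ _ h2, ← integral_div, ← integral_neg]
  congr 1; ext y
  rw [sub_sq_mul_conj_eq, sub_sq_mul_conj_eq, Complex.im_ofReal_mul, Complex.inv_im,
    Complex.normSq_mk, Complex.im_ofReal_mul, Complex.inv_im, Complex.normSq_mk]
  simp only [Complex.conj_re, Complex.conj_im]
  ring

/-- The limit, as `r → 1`, of the integral of `D` against the kernel `(y - r² conj y)⁻¹`, and a
bound that is uniform in `r` and depends on `D` only through `K`, `S` and `B`. -/
lemma tendsto_integral_mul_inv_sub_sq_mul_conj (hDm : Continuous D) (hK : ∀ y, |D y| ≤ K * ‖y‖)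
    (hS : ∀ y, S ≤ ‖y‖ → D y = 0) (hB : ∀ y, |D y| ≤ B)
    (hI : ∀ y, |D y - D (conj y)| ≤ K * |y.im|) :
    (∀ r ∈ Ioo (0 : ℝ) 1, ‖∫ y : ℂ, (D y : ℂ) * (y - (r : ℂ) ^ 2 * conj y)⁻¹‖ ≤
      (∫ t : ℝ, (Metric.closedBall (0 : ℝ) S).indicator (fun _ => B * Real.pi) t) +
      ∫ y : ℂ, (Metric.closedBall (0 : ℂ) S).indicator (fun _ => K) y) ∧
    Tendsto (fun r : ℝ => ∫ y : ℂ, (D y : ℂ) * (y - (r : ℂ) ^ 2 * conj y)⁻¹) (𝓝[<] 1)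
      (𝓝 ((Real.pi / 2 * ∫ t : ℝ, Real.sign t * D t : ℝ) -
        (∫ y : ℂ, (D y - D (conj y)) / (4 * y.im) : ℝ) * I)) := by
  have hK0 : 0 ≤ K := by simpa using (abs_nonneg _).trans (hK 1)
  have hB0 : 0 ≤ B := (abs_nonneg _).trans (hB 0)
  set J : ℝ → ℂ := fun r => ∫ y : ℂ, (D y : ℂ) * (y - (r : ℂ) ^ 2 * conj y)⁻¹ with hJ
  have hev : ∀ᶠ r : ℝ in 𝓝[<] 1, r ∈ Ioo (0 : ℝ) 1 := Ioo_mem_nhdsLT one_pos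
  set R1 : ℝ → ℝ := fun r => ∫ t : ℝ, Real.sign t * lineAverage D ((1 - r ^ 2) / (1 + r ^ 2)) t
    with hR1
  set R2 : ℝ → ℝ := fun r => ∫ y : ℂ, (D y - D (conj y)) / 2 * ((1 + r ^ 2) * y.im /
        (((1 - r ^ 2) * y.re) ^ 2 + ((1 + r ^ 2) * y.im) ^ 2)) with hR2
  have hJeq : ∀ r ∈ Ioo (0 : ℝ) 1, J r = ((1 + r ^ 2)⁻¹ * R1 r : ℝ) - (R2 r : ℝ) * I := by
    intro r hr
    have hint := integrable_mul_inv_sub_sq_mul_conj hDm hK hS (μ := r)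
      (by simpa [abs_of_pos hr.1] using hr.2)
    have hre := integral_re_kernel hDm hK hS hr
    have him := integral_im_kernel hDm hK hS hr
    have e1 : (J r).re = _ := (integral_re hint).symm
    have e2 : (J r).im = _ := (integral_im hint).symm
    apply Complex.ext
    · rw [e1, Complex.sub_re, Complex.ofReal_re, Complex.re_ofReal_mul, I_re, mul_zero, sub_zero]
      exact hre
    · rw [e2, Complex.sub_im, Complex.ofReal_im, Complex.im_ofReal_mul, I_im, mul_one, zero_sub]
      exact him
  have hb1 : ∀ r t : ℝ, ‖Real.sign t * lineAverage D ((1 - r ^ 2) / (1 + r ^ 2)) t‖ ≤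
      (Metric.closedBall (0 : ℝ) S).indicator (fun _ => B * Real.pi) t := by
    intro r t
    rw [norm_mul]
    refine le_trans ?_ (lineAverage_abs_le hB hS ((1 - r ^ 2) / (1 + r ^ 2)) t)
    exact mul_le_of_le_one_left (norm_nonneg _) (abs_realSign_le_one t)
  have hb2 : ∀ r : ℝ, ∀ y : ℂ, ‖(D y - D (conj y)) / 2 * ((1 + r ^ 2) * y.im /
        (((1 - r ^ 2) * y.re) ^ 2 + ((1 + r ^ 2) * y.im) ^ 2))‖ ≤
      (Metric.closedBall (0 : ℂ) S).indicator (fun _ => K) y := by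
    intro r
    refine norm_le_indicator_closedBall (fun y => ?_) (fun y hy => ?_)
    · rw [norm_mul, norm_div, norm_div, Real.norm_eq_abs, Real.norm_eq_abs, Real.norm_eq_abs,
        Real.norm_eq_abs]
      have h1 := hI y
      rcases eq_or_ne y.im 0 with h0 | h0
      · simp [h0, hK0]
      have h0' : 0 < |y.im| := abs_pos.2 h0
      have hd : 0 < 1 + r ^ 2 := by positivity
      have hden : |1 + r ^ 2| * |y.im| * ((1 + r ^ 2) * |y.im|) ≤
          |((1 - r ^ 2) * y.re) ^ 2 + ((1 + r ^ 2) * y.im) ^ 2| := by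
        rw [abs_of_nonneg (by positivity : 0 ≤ ((1 - r ^ 2) * y.re) ^ 2 + ((1 + r ^ 2) * y.im) ^ 2),
          abs_of_pos hd]
        have : ((1 + r ^ 2) * y.im) ^ 2 = (1 + r ^ 2) * |y.im| * ((1 + r ^ 2) * |y.im|) := by
          rw [mul_pow, ← sq_abs y.im]; ring
        linarith [sq_nonneg ((1 - r ^ 2) * y.re)]
      rw [abs_mul]
      calc |D y - D (conj y)| / |2| * (|1 + r ^ 2| * |y.im| /
              |((1 - r ^ 2) * y.re) ^ 2 + ((1 + r ^ 2) * y.im) ^ 2|)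
          ≤ (K * |y.im|) / |2| * (|1 + r ^ 2| * |y.im| /
              (|1 + r ^ 2| * |y.im| * ((1 + r ^ 2) * |y.im|))) := by
            gcongr
        _ = K / (2 * (1 + r ^ 2)) := by
            rw [abs_of_pos hd, abs_two]; field_simp
        _ ≤ K := by
            apply div_le_self hK0; nlinarith [sq_nonneg r]
    · simp [hS y hy, hS (conj y) (by simpa using hy)]
  refine ⟨?_, ?_⟩
  · intro r hr
    have h1 : ‖R1 r‖ ≤ _ := norm_integral_le_of_norm_le
      (integrable_indicator_closedBall volume S (B * Real.pi)) (Eventually.of_forall (hb1 r))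
    have h2 : ‖R2 r‖ ≤ _ := norm_integral_le_of_norm_le
      (integrable_indicator_closedBall volume S K) (Eventually.of_forall (hb2 r))
    change ‖J r‖ ≤ _
    rw [hJeq r hr]
    refine (norm_sub_le _ _).trans (add_le_add ?_ ?_)
    · rw [Complex.norm_real, norm_mul]
      refine (mul_le_of_le_one_left (norm_nonneg _) ?_).trans h1
      rw [norm_inv, Real.norm_eq_abs, abs_of_pos (by positivity)]
      exact inv_le_one_of_one_le₀ (by nlinarith [sq_nonneg r])
    · rw [norm_mul, Complex.norm_I, mul_one, Complex.norm_real]; exact h2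
  · have hfun : J =ᶠ[𝓝[<] 1] fun r => ((1 + r ^ 2)⁻¹ * R1 r : ℝ) - (R2 r : ℝ) * I := by
      filter_upwards [hev] with r hr using hJeq r hr
    refine Tendsto.congr' hfun.symm ?_
    have hcont : ∀ f : ℝ → ℝ, ContinuousAt f 1 → Tendsto f (𝓝[<] 1) (𝓝 (f 1)) :=
      fun f hf => hf.tendsto.mono_left nhdsWithin_le_nhds
    have hε : Tendsto (fun r : ℝ => (1 - r ^ 2) / (1 + r ^ 2)) (𝓝[<] 1) (𝓝 0) := by
      have := hcont (fun r : ℝ => (1 - r ^ 2) / (1 + r ^ 2)) (by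
        refine ContinuousAt.div (by fun_prop) (by fun_prop) (by norm_num))
      simpa using this
    have hinv : Tendsto (fun r : ℝ => (1 + r ^ 2)⁻¹) (𝓝[<] 1) (𝓝 (1 / 2)) := by
      have := hcont (fun r : ℝ => (1 + r ^ 2)⁻¹) (by
        refine ContinuousAt.inv₀ (by fun_prop) (by norm_num))
      convert this using 2; norm_num
    have hR1t : Tendsto R1 (𝓝[<] 1) (𝓝 (∫ t : ℝ, Real.sign t * (Real.pi * D t))) := by
      refine tendsto_integral_filter_of_dominated_convergence _ ?_
        (Eventually.of_forall fun r => Eventually.of_forall (hb1 r))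
        (integrable_indicator_closedBall volume S (B * Real.pi)) ?_
      · refine Eventually.of_forall fun r => ?_
        refine measurable_realSign.aestronglyMeasurable.mul ?_
        have : Continuous fun p : ℝ × ℝ =>
            D ⟨p.1, (1 - r ^ 2) / (1 + r ^ 2) * p.1 * p.2⟩ * (1 + p.2 ^ 2)⁻¹ := by
          refine (hDm.comp (by simp only [Complex.mk_eq_add_mul_I]; fun_prop)).mul ?_
          exact Continuous.inv₀ (by fun_prop) (fun p => by positivity)
        exact (this.stronglyMeasurable.integral_prod_right (ν := volume)).aestronglyMeasurable
      · exact Eventually.of_forall fun t => ((tendsto_lineAverage hDm hB t).comp hε).const_mul _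
    have hR2t : Tendsto R2 (𝓝[<] 1) (𝓝 (∫ y : ℂ, (D y - D (conj y)) / (4 * y.im))) := by
      refine tendsto_integral_filter_of_dominated_convergence _ ?_
        (Eventually.of_forall fun r => Eventually.of_forall (hb2 r))
        (integrable_indicator_closedBall volume S K) ?_
      · refine Eventually.of_forall fun r => Measurable.aestronglyMeasurable ?_
        have := Complex.measurable_re
        have := Complex.measurable_im
        have : Measurable fun y : ℂ => D (conj y) := (hDm.comp Complex.continuous_conj).measurable
        fun_prop
      · refine Eventually.of_forall fun y => ?_
        rcases eq_or_ne y.im 0 with h0 | h0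
        · simp [h0]
        have := hcont (fun r : ℝ => (D y - D (conj y)) / 2 * ((1 + r ^ 2) * y.im /
          (((1 - r ^ 2) * y.re) ^ 2 + ((1 + r ^ 2) * y.im) ^ 2))) (by
            refine ContinuousAt.mul (by fun_prop) (ContinuousAt.div (by fun_prop) (by fun_prop) ?_)
            have : (1 : ℝ) + 1 ^ 2 ≠ 0 := by norm_num
            have : 0 < ((1 + 1 ^ 2) * y.im) ^ 2 := by positivity
            have := this
            positivity)
        convert this using 2
        norm_num
        field_simp
        norm_num
    have h1 := hinv.mul hR1t
    have e : Real.pi / 2 * ∫ t : ℝ, Real.sign t * D t =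
        1 / 2 * ∫ t : ℝ, Real.sign t * (Real.pi * D t) := by
      rw [div_mul_eq_mul_div, one_div, mul_comm, inv_mul_eq_div, ← integral_mul_const]
      congr 2; ext t; ring
    rw [e]
    exact (Complex.continuous_ofReal.continuousAt.tendsto.comp h1).sub
      ((Complex.continuous_ofReal.continuousAt.tendsto.comp hR2t).mul_const I)

end kernel

/-! ### Ray integrals and the holomorphic integrating factor -/

section ray
open MeasureTheory

variable {E : Type*} [NormedAddCommGroup E] [NormedSpace ℝ E] {R : ℝ}

/-- The integral of `k` over the half-line that ends at `z` and has direction `l`. -/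
def rayIntegral (k : ℂ → E) (z l : ℂ) : E := ∫ t in Iic (0 : ℝ), k (z + t * l)

lemma norm_add_mul_ge {l : ℂ} (hl : ‖l‖ = 1) (z : ℂ) (t : ℝ) : |t| - ‖z‖ ≤ ‖z + t * l‖ := by
  have := norm_sub_norm_le ((t : ℂ) * l) (-z)
  rw [norm_neg, norm_mul, hl, mul_one, Complex.norm_real, Real.norm_eq_abs, sub_neg_eq_add,
    add_comm ((t : ℂ) * l)] at this
  exact this

omit [NormedSpace ℝ E] in
lemma integrable_comp_line {k : ℂ → E} (hk : Continuous k) (hR : ∀ y, R ≤ ‖y‖ → k y = 0)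
    {l : ℂ} (hl : ‖l‖ = 1) (z : ℂ) : Integrable fun t : ℝ => k (z + t * l) := by
  refine Continuous.integrable_of_hasCompactSupport (by fun_prop) ?_
  refine HasCompactSupport.intro (isCompact_closedBall (0 : ℝ) (R + ‖z‖)) fun t ht => hR _ ?_
  have := norm_add_mul_ge hl z t
  simp only [Metric.mem_closedBall, dist_zero_right, Real.norm_eq_abs, not_le] at ht
  linarith

/-- Near a given parameter, the ray integral is an integral over a fixed compact interval. -/
lemma continuous_rayIntegral {X : Type*} [TopologicalSpace X] [FirstCountableTopology X]
    {k : X → ℂ → E} (hk : Continuous (Function.uncurry k))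
    (hR : ∀ x y, R ≤ ‖y‖ → k x y = 0) {z l : X → ℂ} (hz : Continuous z) (hlc : Continuous l)
    (hl : ∀ x, ‖l x‖ = 1) : Continuous fun x => rayIntegral (k x) (z x) (l x) := by
  rw [continuous_iff_continuousAt]
  intro x₀
  set M := ‖z x₀‖ + 1 + |R| with hM
  have hM0 : 0 ≤ M := by positivity
  have hcont : Continuous fun x => ∫ t in (-M)..0, k x (z x + t * l x) := by
    refine intervalIntegral.continuous_parametric_intervalIntegral_of_continuous' ?_ _ _
    exact hk.comp (by fun_prop : Continuous fun p : X × ℝ => (p.1, z p.1 + p.2 * l p.1))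
  refine hcont.continuousAt.congr ?_
  have hev : ∀ᶠ x in 𝓝 x₀, ‖z x‖ < ‖z x₀‖ + 1 :=
    (hz.norm.continuousAt (x := x₀)).eventually_lt continuousAt_const (by simp)
  filter_upwards [hev] with x hx
  rw [intervalIntegral.integral_of_le (by linarith), rayIntegral]
  symm
  refine setIntegral_eq_of_subset_of_forall_sdiff_eq_zero measurableSet_Iic
    (fun t ht => ht.2) fun t ht => hR _ _ ?_
  have h1 : t ≤ -M := by
    by_contra h; exact ht.2 ⟨not_le.1 h, ht.1⟩
  have := norm_add_mul_ge (hl x) (z x) t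
  rw [abs_of_nonpos (by linarith)] at this
  linarith [le_abs_self R]

lemma rayIntegral_add_mul (k : ℂ → E) (z l : ℂ) (τ : ℝ) :
    rayIntegral k (z + τ * l) l = ∫ t in Iic τ, k (z + t * l) := by
  have h := (measurePreserving_add_left volume τ).setIntegral_preimage_emb
    (measurableEmbedding_addLeft τ) (fun t : ℝ => k (z + t * l)) (Iic τ)
  rw [← h, rayIntegral]
  have : (fun x : ℝ => τ + x) ⁻¹' Iic τ = Iic 0 := by ext; simp
  rw [this]
  refine setIntegral_congr_fun measurableSet_Iic fun t _ => ?_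
  congr 1; push_cast; ring

lemma rayIntegral_neg (k : ℂ → E) (z l : ℂ) :
    rayIntegral k z (-l) = ∫ t in Ioi (0 : ℝ), k (z + t * l) := by
  have := integral_comp_neg_Iic (0 : ℝ) (fun t : ℝ => k (z + t * l))
  rw [neg_zero] at this
  rw [← this, rayIntegral]
  refine setIntegral_congr_fun measurableSet_Iic fun t _ => ?_
  simp

lemma rayIntegral_add_rayIntegral_neg {k : ℂ → E} (hk : Continuous k)
    (hR : ∀ y, R ≤ ‖y‖ → k y = 0) {l : ℂ} (hl : ‖l‖ = 1) (z : ℂ) :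
    rayIntegral k z l + rayIntegral k z (-l) = ∫ t : ℝ, k (z + t * l) := by
  have hi := integrable_comp_line hk hR hl z
  rw [rayIntegral_neg, rayIntegral,
    intervalIntegral.integral_Iic_add_Ioi hi.integrableOn hi.integrableOn]

lemma hasDerivAt_rayIntegral [CompleteSpace E] {k : ℂ → E} (hk : Continuous k)
    (hR : ∀ y, R ≤ ‖y‖ → k y = 0) {l : ℂ} (hl : ‖l‖ = 1) (z : ℂ) (τ : ℝ) :
    HasDerivAt (fun τ : ℝ => rayIntegral k (z + τ * l) l) (k (z + τ * l)) τ := by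
  have hi := integrable_comp_line hk hR hl z
  have h : (fun τ : ℝ => rayIntegral k (z + τ * l) l) = fun τ =>
      rayIntegral k z l + ∫ t in (0 : ℝ)..τ, k (z + t * l) := by
    ext τ
    rw [rayIntegral_add_mul,
      ← intervalIntegral.integral_Iic_sub_Iic hi.integrableOn hi.integrableOn, rayIntegral]
    abel
  rw [h]
  have hc : Continuous fun t : ℝ => k (z + t * l) := by fun_prop
  exact (intervalIntegral.integral_hasDerivAt_right (hc.intervalIntegrable _ _)
    (hc.stronglyMeasurableAtFilter _ _) hc.continuousAt).const_add _

lemma hasDerivAt_rayIntegral_neg [CompleteSpace E] {k : ℂ → E} (hk : Continuous k)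
    (hR : ∀ y, R ≤ ‖y‖ → k y = 0) {l : ℂ} (hl : ‖l‖ = 1) (z : ℂ) (τ : ℝ) :
    HasDerivAt (fun τ : ℝ => rayIntegral k (z + τ * l) (-l)) (-k (z + τ * l)) τ := by
  have h := (hasDerivAt_rayIntegral hk hR (by rwa [norm_neg] : ‖-l‖ = 1) z (-τ)).scomp τ
    (hasDerivAt_neg τ)
  refine (h.congr_deriv ?_).congr_of_eventuallyEq (Eventually.of_forall fun s => ?_)
  · simp
  · simp

/-- If the integral of `k` over a whole line vanishes, then so do the ray integrals at the points
outside the ball that carries `k`: a line through such a point meets the convex ball on at most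
one side of it. -/
lemma rayIntegral_eq_zero {k : ℂ → E} (hk : Continuous k) (hR : ∀ y, R ≤ ‖y‖ → k y = 0) {l : ℂ}
    (hl : ‖l‖ = 1) {z : ℂ} (hz : R ≤ ‖z‖) (h0 : ∫ t : ℝ, k (z + t * l) = 0) :
    rayIntegral k z l = 0 := by
  by_cases h : ∃ t₁ : ℝ, t₁ ≤ 0 ∧ k (z + t₁ * l) ≠ 0
  · obtain ⟨t₁, ht₁, hk₁⟩ := h
    have hpos : rayIntegral k z (-l) = 0 := by
      rw [rayIntegral_neg]
      refine setIntegral_eq_zero_of_forall_eq_zero fun t₂ ht₂ => ?_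
      by_contra hk₂
      have b1 : z + t₁ * l ∈ Metric.ball (0 : ℂ) R := by
        by_contra h; exact hk₁ (hR _ (by simpa using h))
      have b2 : z + t₂ * l ∈ Metric.ball (0 : ℂ) R := by
        by_contra h; exact hk₂ (hR _ (by simpa using h))
      have ht₂ : 0 < t₂ := ht₂
      have hd : 0 < t₂ - t₁ := by linarith
      have := (convex_ball (0 : ℂ) R) b1 b2 (a := t₂ / (t₂ - t₁)) (b := -t₁ / (t₂ - t₁))
        (by positivity) (div_nonneg (by linarith) hd.le) (by field_simp; ring)
      have e : (t₂ / (t₂ - t₁)) • (z + t₁ * l) + (-t₁ / (t₂ - t₁)) • (z + t₂ * l) = z := by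
        have hd' : (t₂ - t₁ : ℂ) ≠ 0 := by exact_mod_cast hd.ne'
        simp only [Complex.real_smul]; push_cast
        field_simp; ring
      rw [e] at this
      simp only [Metric.mem_ball, dist_zero_right] at this
      linarith
    have := rayIntegral_add_rayIntegral_neg hk hR hl z
    rwa [hpos, h0, add_zero] at this
  · push Not at h
    exact setIntegral_eq_zero_of_forall_eq_zero fun t ht => h t ht

end ray

section factor
open MeasureTheory ComplexConjugate Complex

variable {a : ℂ → ℝ} {L : NNReal} {R : ℝ}

/-- Up to a constant, the Hilbert transform of the Radon transform of `a`: with `y = t + i s`,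
the integral over `t` of `a (z - l * y)` is the integral of `a` over a line of direction `l`, and
the principal value of its product with `1 / s` is written as an integral of the symmetric
difference `y ↔ conj y`, which is bounded for Lipschitz `a`. -/
def radonHilbert (a : ℂ → ℝ) (z l : ℂ) : ℝ :=
  ∫ y : ℂ, (a (z - l * y) - a (z - l * conj y)) / (2 * y.im)

/-- `radonHilbert` depends on `z` only through the line of direction `l` on which `z` lies. -/
lemma radonHilbert_add_mul (a : ℂ → ℝ) (z l : ℂ) (τ : ℝ) :
    radonHilbert a (z + τ * l) l = radonHilbert a z l := by
  rw [radonHilbert, radonHilbert, ← integral_add_right_eq_self _ (τ : ℂ)]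
  congr 1; ext y
  rw [Complex.add_im, Complex.ofReal_im, add_zero, map_add, Complex.conj_ofReal]
  have e : ∀ w : ℂ, z + τ * l - l * (w + τ) = z - l * w := fun w => by ring
  rw [e, e]

lemma abs_sub_conj_le (ha : LipschitzWith L a) {l : ℂ} (hl : ‖l‖ = 1) (z y : ℂ) :
    |a (z - l * y) - a (z - l * conj y)| ≤ 2 * L * |y.im| := by
  have := ha.dist_le_mul (z - l * y) (z - l * conj y)
  rw [Real.dist_eq, dist_eq_norm] at this
  have e : z - l * y - (z - l * conj y) = -(l * (y - conj y)) := by ring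
  rw [e, norm_neg, norm_mul, hl, one_mul, Complex.sub_conj, norm_mul, Complex.norm_I, mul_one,
    Complex.norm_real, norm_mul, Real.norm_eq_abs, Real.norm_eq_abs, abs_two] at this
  linarith

lemma norm_sub_mul_ge {l : ℂ} (hl : ‖l‖ = 1) (z y : ℂ) : ‖y‖ - ‖z‖ ≤ ‖z - l * y‖ := by
  have := norm_sub_norm_le (l * y) z
  rwa [norm_mul, hl, one_mul, norm_sub_rev] at this

lemma measurable_sub_conj_div (ha : Continuous a) (z l : ℂ) :
    Measurable fun y : ℂ => (a (z - l * y) - a (z - l * conj y)) / (2 * y.im) := by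
  have := Complex.measurable_im
  have h1 : Measurable fun y : ℂ => a (z - l * y) := by fun_prop
  have h2 : Measurable fun y : ℂ => a (z - l * conj y) :=
    h1.comp Complex.continuous_conj.measurable
  exact (h1.sub h2).div (by fun_prop)

lemma norm_sub_conj_div_le (ha : LipschitzWith L a) {l : ℂ} (hl : ‖l‖ = 1) (z y : ℂ) :
    ‖(a (z - l * y) - a (z - l * conj y)) / (2 * y.im)‖ ≤ L := by
  have h := abs_sub_conj_le ha hl z y
  rw [norm_div, Real.norm_eq_abs, Real.norm_eq_abs, abs_mul, abs_two]
  rcases eq_or_ne y.im 0 with h0 | h0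
  · simp [h0]
  have : 0 < |y.im| := abs_pos.2 h0
  rw [div_le_iff₀ (by positivity)]
  linarith

lemma sub_conj_div_eq_zero (hR : ∀ y, R ≤ ‖y‖ → a y = 0) {l : ℂ} (hl : ‖l‖ = 1) {z y : ℂ}
    (hy : R + ‖z‖ ≤ ‖y‖) : (a (z - l * y) - a (z - l * conj y)) / (2 * y.im) = 0 := by
  have h1 := norm_sub_mul_ge hl z y
  have h2 := norm_sub_mul_ge hl z (conj y)
  rw [Complex.norm_conj] at h2
  rw [hR _ (by linarith), hR _ (by linarith)]; simp

lemma continuous_radonHilbert (ha : LipschitzWith L a) (hR : ∀ y, R ≤ ‖y‖ → a y = 0) :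
    Continuous fun p : ℂ × ℝ => radonHilbert a p.1 (exp (p.2 * I)) := by
  have hac := ha.continuous
  rw [continuous_iff_continuousAt]
  intro p₀
  refine continuousAt_of_dominated
    (bound := (Metric.closedBall (0 : ℂ) (R + (‖p₀.1‖ + 1))).indicator (fun _ => (L : ℝ)))
    (Eventually.of_forall fun p => (measurable_sub_conj_div hac _ _).aestronglyMeasurable) ?_
    (integrable_indicator_closedBall _ _ _) ?_
  · have hev : ∀ᶠ p in 𝓝 p₀, ‖p.1‖ < ‖p₀.1‖ + 1 :=
      (continuous_fst.norm.continuousAt (x := p₀)).eventually_lt continuousAt_const (by simp)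
    filter_upwards [hev] with p hp
    exact Eventually.of_forall (norm_le_indicator_closedBall
      (norm_sub_conj_div_le ha (norm_exp_ofReal_mul_I p.2) p.1)
      fun y hy => sub_conj_div_eq_zero hR (norm_exp_ofReal_mul_I p.2) (by linarith))
  · refine Eventually.of_forall fun y => Continuous.continuousAt ?_
    fun_prop

/-- Half the difference of the integrals of `a` over the two rays from `z` of directions `-l`
and `l`. -/
def halfBeamDiff (a : ℂ → ℝ) (z l : ℂ) : ℝ := (rayIntegral a z l - rayIntegral a z (-l)) / 2

lemma hasDerivAt_halfBeamDiff (ha : Continuous a) (hR : ∀ y, R ≤ ‖y‖ → a y = 0) {l : ℂ}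
    (hl : ‖l‖ = 1) (z : ℂ) (τ : ℝ) :
    HasDerivAt (fun τ : ℝ => halfBeamDiff a (z + τ * l) l) (a (z + τ * l)) τ := by
  have := ((hasDerivAt_rayIntegral ha hR hl z τ).sub
    (hasDerivAt_rayIntegral_neg ha hR hl z τ)).div_const 2
  refine this.congr_deriv ?_
  ring

lemma continuous_halfBeamDiff (ha : Continuous a) (hR : ∀ y, R ≤ ‖y‖ → a y = 0) :
    Continuous fun p : ℂ × ℝ => halfBeamDiff a p.1 (exp (p.2 * I)) := by
  have h1 := continuous_rayIntegral (X := ℂ × ℝ) (k := fun _ => a)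
    (ha.comp continuous_snd) (fun _ => hR) continuous_fst
    (by fun_prop : Continuous fun p : ℂ × ℝ => exp (p.2 * I)) (fun p => norm_exp_ofReal_mul_I p.2)
  have h2 := continuous_rayIntegral (X := ℂ × ℝ) (k := fun _ => a)
    (ha.comp continuous_snd) (fun _ => hR) continuous_fst
    (by fun_prop : Continuous fun p : ℂ × ℝ => -exp (p.2 * I))
    (fun p => by rw [norm_neg]; exact norm_exp_ofReal_mul_I p.2)
  exact (h1.sub h2).div_const 2

/-- The logarithm `w` of the holomorphic integrating factor. It satisfies `l · ∇w = a`, and it is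
the boundary value, at `l` on the unit circle, of the function `discFactor a z`, which is
holomorphic in the unit disc. -/
def holFactor (a : ℂ → ℝ) (z l : ℂ) : ℂ :=
  halfBeamDiff a z l - (radonHilbert a z l / (2 * Real.pi) : ℝ) * I

lemma continuous_holFactor (ha : LipschitzWith L a) (hR : ∀ y, R ≤ ‖y‖ → a y = 0) :
    Continuous fun p : ℂ × ℝ => holFactor a p.1 (exp (p.2 * I)) := by
  have h1 := continuous_halfBeamDiff ha.continuous hR
  have h2 := continuous_radonHilbert ha hR
  unfold holFactor
  fun_prop

/-- The integral of `a (z - y)` against the fundamental solution `μ / (π (y - μ² conj y))` of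
`μ ∂ + μ⁻¹ ∂̄`, for `μ` in the unit disc. The kernel is odd in `y`, and `a (z - y)` is replaced by
its odd part in order to cancel the singularity at `y = 0`. -/
def discFactor (a : ℂ → ℝ) (z μ : ℂ) : ℂ :=
  (2 * Real.pi : ℝ)⁻¹ * μ * ∫ y : ℂ, ((a (z - y) - a (z + y) : ℝ) : ℂ) * (y - μ ^ 2 * conj y)⁻¹

lemma abs_sub_add_le (ha : LipschitzWith L a) {l : ℂ} (hl : ‖l‖ = 1) (z y : ℂ) :
    |a (z - l * y) - a (z + l * y)| ≤ 4 * L * ‖y‖ := by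
  have := ha.dist_le_mul (z - l * y) (z + l * y)
  rw [Real.dist_eq, dist_eq_norm] at this
  have e : z - l * y - (z + l * y) = -(2 * (l * y)) := by ring
  rw [e, norm_neg, norm_mul, norm_mul, hl, one_mul, Complex.norm_ofNat] at this
  have : 0 ≤ L * ‖y‖ := by positivity
  linarith

lemma sub_add_eq_zero (hR : ∀ y, R ≤ ‖y‖ → a y = 0) {l : ℂ} (hl : ‖l‖ = 1) (z y : ℂ)
    (hy : R + ‖z‖ ≤ ‖y‖) : a (z - l * y) - a (z + l * y) = 0 := by
  have h1 := norm_sub_mul_ge hl z y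
  have h2 := norm_sub_mul_ge (l := -l) (by rwa [norm_neg]) z y
  rw [neg_mul, sub_neg_eq_add] at h2
  rw [hR _ (by linarith), hR _ (by linarith), sub_zero]

lemma differentiableOn_discFactor (ha : LipschitzWith L a) (hR : ∀ y, R ≤ ‖y‖ → a y = 0) (z : ℂ) :
    DifferentiableOn ℂ (discFactor a z) (Metric.ball 0 1) := by
  have hac := ha.continuous
  have hK : ∀ y, |a (z - y) - a (z + y)| ≤ 4 * L * ‖y‖ := fun y => by
    simpa using abs_sub_add_le ha (l := 1) (by simp) z y
  have hS : ∀ y, R + ‖z‖ ≤ ‖y‖ → a (z - y) - a (z + y) = 0 := fun y hy => by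
    simpa using sub_add_eq_zero hR (l := 1) (by simp) z y hy
  have hc : Continuous fun y => a (z - y) - a (z + y) := by fun_prop
  intro μ₀ hμ₀
  have hμ₀' : ‖μ₀‖ < 1 := by simpa using hμ₀
  obtain ⟨ρ, hρ1, hρ2⟩ := exists_between hμ₀'
  have hρ0 : 0 < ρ := (norm_nonneg _).trans_lt hρ1
  have hs : Metric.ball (0 : ℂ) ρ ∈ 𝓝 μ₀ := Metric.isOpen_ball.mem_nhds (by simpa using hρ1)
  have h1 : 0 < 1 - ρ ^ 2 := by nlinarith
  have hden : ∀ μ ∈ Metric.ball (0 : ℂ) ρ, ∀ y : ℂ, (1 - ρ ^ 2) * ‖y‖ ≤ ‖y - μ ^ 2 * conj y‖ := by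
    intro μ hμ y
    have hμ' : ‖μ‖ < ρ := by simpa using hμ
    refine le_trans ?_ (norm_sub_sq_mul_conj_ge y)
    gcongr
  have key := hasDerivAt_integral_of_dominated_loc_of_deriv_le (μ := volume) (𝕜 := ℂ)
    (F := fun μ (y : ℂ) => ((a (z - y) - a (z + y) : ℝ) : ℂ) * (y - μ ^ 2 * conj y)⁻¹)
    (F' := fun μ (y : ℂ) => ((a (z - y) - a (z + y) : ℝ) : ℂ) *
      (2 * μ * conj y / (y - μ ^ 2 * conj y) ^ 2))
    (bound := (Metric.closedBall (0 : ℂ) (R + ‖z‖)).indicator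
      (fun _ => 4 * L * 2 / (1 - ρ ^ 2) ^ 2)) hs
    (by
      filter_upwards [hs] with μ hμ
      exact (integrable_mul_inv_sub_sq_mul_conj hc hK hS
        ((by simpa using hμ : ‖μ‖ < ρ).trans hρ2)).aestronglyMeasurable)
    (integrable_mul_inv_sub_sq_mul_conj hc hK hS hμ₀')
    (Measurable.aestronglyMeasurable (by
      have := hc.measurable
      fun_prop))
    (Eventually.of_forall fun y μ hμ => by
      refine norm_le_indicator_closedBall (f := fun y : ℂ => ((a (z - y) - a (z + y) : ℝ) : ℂ) *
        (2 * μ * conj y / (y - μ ^ 2 * conj y) ^ 2)) (fun y => ?_) (fun y hy => ?_) y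
      · rcases eq_or_ne y 0 with rfl | hy
        · simp; positivity
        have hy0 : 0 < ‖y‖ := norm_pos_iff.2 hy
        have hμ' : ‖μ‖ ≤ 1 := (by simpa using hμ : ‖μ‖ < ρ).le.trans hρ2.le
        rw [norm_mul, norm_div, norm_mul, norm_mul, norm_pow, Complex.norm_conj,
          Complex.norm_ofNat, Complex.norm_real]
        calc ‖a (z - y) - a (z + y)‖ * (2 * ‖μ‖ * ‖y‖ / ‖y - μ ^ 2 * conj y‖ ^ 2)
            ≤ (4 * L * ‖y‖) * (2 * 1 * ‖y‖ / ((1 - ρ ^ 2) * ‖y‖) ^ 2) := by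
              gcongr
              · exact hK y
              · exact hden μ hμ y
          _ = 4 * L * 2 / (1 - ρ ^ 2) ^ 2 := by field_simp
      · simp only [hS y hy]; simp)
    (integrable_indicator_closedBall _ _ _)
    (Eventually.of_forall fun y μ hμ => by
      rcases eq_or_ne y 0 with rfl | hy
      · simpa using hasDerivAt_const μ (0 : ℂ)
      have hne : y - μ ^ 2 * conj y ≠ 0 := by
        rw [← norm_pos_iff]
        exact lt_of_lt_of_le (mul_pos h1 (norm_pos_iff.2 hy)) (hden μ hμ y)
      have hd : HasDerivAt (fun μ : ℂ => y - μ ^ 2 * conj y) (-(2 * μ * conj y)) μ := by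
        have := (((hasDerivAt_pow 2 μ).mul_const (conj y)).const_sub y)
        simpa using this
      have := (hd.inv hne).const_mul ((a (z - y) - a (z + y) : ℝ) : ℂ)
      simpa using this)
  have h3 := (((hasDerivAt_id μ₀).const_mul ((2 * Real.pi : ℝ)⁻¹ : ℂ)).mul key.2)
  exact (h3.congr_of_eventuallyEq
    (Eventually.of_forall fun μ => by simp [discFactor])).differentiableAt.differentiableWithinAt

/-- The rotation `y ↦ l * y` takes the kernel at `r * l` to the kernel at `r`. -/
lemma discFactor_mul_eq (a : ℂ → ℝ) (z : ℂ) {l : ℂ} (hl : ‖l‖ = 1) (r : ℝ) :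
    discFactor a z (r * l) = (2 * Real.pi : ℝ)⁻¹ * r *
      ∫ y : ℂ, ((a (z - l * y) - a (z + l * y) : ℝ) : ℂ) * (y - (r : ℂ) ^ 2 * conj y)⁻¹ := by
  have h : ∫ y : ℂ, ((a (z - l * y) - a (z + l * y) : ℝ) : ℂ) *
      (l * y - (r * l) ^ 2 * conj (l * y))⁻¹ = ∫ y : ℂ, ((a (z - y) - a (z + y) : ℝ) : ℂ) *
      (y - (r * l) ^ 2 * conj y)⁻¹ :=
    (rotation (⟨l, mem_sphere_zero_iff_norm.2 hl⟩ : Circle)).measurePreserving.integral_comp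
    (rotation (⟨l, mem_sphere_zero_iff_norm.2 hl⟩ : Circle)).toHomeomorph.measurableEmbedding
    (fun y : ℂ => ((a (z - y) - a (z + y) : ℝ) : ℂ) * (y - (r * l) ^ 2 * conj y)⁻¹)
  have hl0 : l ≠ 0 := by rw [← norm_pos_iff, hl]; norm_num
  have hll : l * conj l = 1 := by rw [Complex.mul_conj, Complex.normSq_eq_norm_sq, hl]; simp
  rw [discFactor, ← h, mul_assoc, mul_assoc, mul_assoc, ← integral_const_mul l]
  congr 3; ext y
  have e : l * y - (r * l) ^ 2 * conj (l * y) = l * (y - (r : ℂ) ^ 2 * conj y) := by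
    rw [map_mul]
    linear_combination (- (r : ℂ) ^ 2 * l * conj y) * hll
  rw [e, mul_inv]
  field_simp

lemma integrable_sub_conj_div (ha : LipschitzWith L a) (hR : ∀ y, R ≤ ‖y‖ → a y = 0) {l : ℂ}
    (hl : ‖l‖ = 1) (z : ℂ) :
    Integrable fun y : ℂ => (a (z - l * y) - a (z - l * conj y)) / (2 * y.im) :=
  integrable_of_norm_le_of_eq_zero (measurable_sub_conj_div ha.continuous z l).aestronglyMeasurable
    (norm_sub_conj_div_le ha hl z) fun _ hy => sub_conj_div_eq_zero hR hl hy

/-- The two halves of the integrand correspond to each other under `y ↦ -y`. -/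
lemma integral_sub_sub_conj (ha : LipschitzWith L a) (hR : ∀ y, R ≤ ‖y‖ → a y = 0) {l : ℂ}
    (hl : ‖l‖ = 1) (z : ℂ) :
    ∫ y : ℂ, (a (z - l * y) - a (z + l * y) - (a (z - l * conj y) - a (z + l * conj y))) /
      (4 * y.im) = radonHilbert a z l := by
  have hi := integrable_sub_conj_div ha hR hl z
  have h1 := integral_neg_eq_self (fun y : ℂ => (a (z - l * y) - a (z - l * conj y)) / (2 * y.im))
    volume
  have h2 := integral_add hi hi.comp_neg
  rw [h1, ← two_mul] at h2
  rw [radonHilbert, ← mul_right_inj' (two_ne_zero (α := ℝ)), ← h2, ← integral_const_mul]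
  congr 1; ext y
  simp only [map_neg, Complex.neg_im, mul_neg, sub_neg_eq_add]
  rcases eq_or_ne y.im 0 with h0 | h0
  · simp [h0]
  field_simp
  ring

lemma integral_sign_mul_sub (ha : Continuous a) (hR : ∀ y, R ≤ ‖y‖ → a y = 0) {l : ℂ}
    (hl : ‖l‖ = 1) (z : ℂ) :
    ∫ t : ℝ, Real.sign t * (a (z - l * t) - a (z + l * t)) =
      2 * (rayIntegral a z l - rayIntegral a z (-l)) := by
  have i1 := integrable_comp_line ha hR hl z
  have i2 := integrable_comp_line ha hR (l := -l) (by rwa [norm_neg]) z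
  have e1 : ∫ t in Ioi (0 : ℝ), Real.sign t * (a (z - l * t) - a (z + l * t)) =
      rayIntegral a z l - rayIntegral a z (-l) := by
    have h := rayIntegral_neg a z (-l)
    rw [neg_neg] at h
    rw [rayIntegral_neg, h, ← integral_sub i2.integrableOn i1.integrableOn]
    refine setIntegral_congr_fun measurableSet_Ioi fun t ht => ?_
    rw [Real.sign_of_pos ht, one_mul, mul_neg, ← sub_eq_add_neg, mul_comm l]
  have e2 : ∫ t in Iic (0 : ℝ), Real.sign t * (a (z - l * t) - a (z + l * t)) =
      rayIntegral a z l - rayIntegral a z (-l) := by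
    rw [rayIntegral, rayIntegral, ← integral_sub i1.integrableOn i2.integrableOn]
    refine setIntegral_congr_fun measurableSet_Iic fun t ht => ?_
    rcases (show t ≤ 0 from ht).lt_or_eq with h | rfl
    · rw [Real.sign_of_neg h, mul_neg, ← sub_eq_add_neg, mul_comm l]; ring
    · simp
  have hi : Integrable fun t : ℝ => Real.sign t * (a (z - l * t) - a (z + l * t)) := by
    refine Integrable.bdd_mul (c := 1) ?_ measurable_realSign.aestronglyMeasurable
      (Eventually.of_forall abs_realSign_le_one)
    refine (i2.sub i1).congr (Eventually.of_forall fun t => ?_)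
    simp only [Pi.sub_apply, mul_neg, ← sub_eq_add_neg, mul_comm l]
  rw [← intervalIntegral.integral_Iic_add_Ioi hi.integrableOn hi.integrableOn, e1, e2]; ring

/-- `discFactor a z` is bounded on the disc and has the radial limits `holFactor a z`. -/
lemma exists_norm_discFactor_le_and_tendsto (ha : LipschitzWith L a)
    (hR : ∀ y, R ≤ ‖y‖ → a y = 0) (z : ℂ) :
    (∃ C, ∀ μ ∈ Metric.ball (0 : ℂ) 1, ‖discFactor a z μ‖ ≤ C) ∧
    ∀ l : ℂ, ‖l‖ = 1 → Tendsto (fun r : ℝ => discFactor a z (r * l)) (𝓝[<] 1)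
      (𝓝 (holFactor a z l)) := by
  have hac := ha.continuous
  obtain ⟨B, hB⟩ : ∃ B, ∀ y, |a y| ≤ B := by
    obtain ⟨B, hB⟩ := (isCompact_closedBall (0 : ℂ) R).exists_bound_of_continuousOn hac.continuousOn
    refine ⟨max B 0, fun y => ?_⟩
    rcases le_total ‖y‖ R with h | h
    · exact (hB y (by simpa using h)).trans (le_max_left _ _)
    · rw [hR y h]; simp
  have main : ∀ l : ℂ, ‖l‖ = 1 → _ := fun l hl =>
    tendsto_integral_mul_inv_sub_sq_mul_conj (D := fun y => a (z - l * y) - a (z + l * y))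
      (K := 4 * L) (S := R + ‖z‖) (B := 2 * B) (by fun_prop) (abs_sub_add_le ha hl z)
      (sub_add_eq_zero hR hl z)
      (fun y => by
        refine (abs_sub _ _).trans ?_
        linarith [hB (z - l * y), hB (z + l * y)])
      (fun y => by
        have h1 := abs_sub_conj_le ha hl z y
        have h2 := abs_sub_conj_le ha (l := -l) (by rwa [norm_neg]) z y
        simp only [neg_mul, sub_neg_eq_add] at h2
        have e : a (z - l * y) - a (z + l * y) - (a (z - l * conj y) - a (z + l * conj y)) =
          (a (z - l * y) - a (z - l * conj y)) - (a (z + l * y) - a (z + l * conj y)) := by ring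
        rw [e]
        refine (abs_sub _ _).trans ?_
        linarith)
  refine ⟨?_, ?_⟩
  · refine ⟨(2 * Real.pi)⁻¹ * ((∫ t : ℝ, (Metric.closedBall (0 : ℝ) (R + ‖z‖)).indicator
      (fun _ => 2 * B * Real.pi) t) +
      ∫ y : ℂ, (Metric.closedBall (0 : ℂ) (R + ‖z‖)).indicator (fun _ => 4 * (L : ℝ)) y),
      fun μ hμ => ?_⟩
    have hB0 : 0 ≤ B := (abs_nonneg _).trans (hB 0)
    have hpos : 0 ≤ ((∫ t : ℝ, (Metric.closedBall (0 : ℝ) (R + ‖z‖)).indicator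
      (fun _ => 2 * B * Real.pi) t) +
      ∫ y : ℂ, (Metric.closedBall (0 : ℂ) (R + ‖z‖)).indicator (fun _ => 4 * (L : ℝ)) y) :=
      add_nonneg (integral_nonneg (indicator_nonneg fun _ _ => by positivity))
        (integral_nonneg (indicator_nonneg fun _ _ => by positivity))
    rcases eq_or_ne μ 0 with rfl | h0
    · simp only [discFactor, mul_zero, zero_mul, norm_zero]
      positivity
    have hn : 0 < ‖μ‖ := norm_pos_iff.2 h0
    have hn1 : ‖μ‖ < 1 := by simpa using hμ
    have hl : ‖μ / ‖μ‖‖ = 1 := by simp [hn.ne']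
    have e : μ = (‖μ‖ : ℝ) * (μ / ‖μ‖) := by
      rw [mul_div_cancel₀]; exact_mod_cast hn.ne'
    have h1 := (main _ hl).1 ‖μ‖ ⟨hn, hn1⟩
    have h2 := discFactor_mul_eq a z hl ‖μ‖
    rw [← e] at h2
    rw [h2, norm_mul, norm_mul, Complex.norm_real, Complex.norm_real, norm_norm,
      Real.norm_of_nonneg (by positivity)]
    refine mul_le_mul ?_ h1 (norm_nonneg _) (by positivity)
    exact mul_le_of_le_one_right (by positivity) hn1.le
  · intro l hl
    have h1 := (main l hl).2
    rw [integral_sign_mul_sub hac hR hl, integral_sub_sub_conj ha hR hl] at h1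
    have hr : Tendsto (fun r : ℝ => (((2 * Real.pi : ℝ)⁻¹ : ℝ) : ℂ) * (r : ℂ)) (𝓝[<] 1)
        (𝓝 ((((2 * Real.pi : ℝ)⁻¹ : ℝ) : ℂ) * ((1 : ℝ) : ℂ))) :=
      (Continuous.tendsto (by fun_prop) _).mono_left nhdsWithin_le_nhds
    have h2 := (hr.mul h1).congr fun r => (discFactor_mul_eq a z hl r).symm
    convert h2 using 2
    rw [holFactor, halfBeamDiff]
    push_cast
    have : (Real.pi : ℂ) ≠ 0 := by exact_mod_cast Real.pi_ne_zero
    field_simp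

end factor

/-! ### Transport equations and their Fourier modes -/

section modes
open MeasureTheory ComplexConjugate Complex
open scoped FourierTransform RealInnerProductSpace

variable {R : ℝ} {k v F : ℝ → ℂ → ℂ}

lemma integrable_of_eq_zero {f : ℂ → ℂ} (hf : Continuous f) (hR : ∀ z, R ≤ ‖z‖ → f z = 0) :
    Integrable f := by
  refine hf.integrable_of_hasCompactSupport
    (HasCompactSupport.intro (isCompact_closedBall (0 : ℂ) R) fun z hz => hR z ?_)
  simpa using (not_le.1 (by simpa using hz : ¬ ‖z‖ ≤ R)).le

lemma integral_interval_swap (hF : Continuous (Function.uncurry F))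
    (hR : ∀ φ z, R ≤ ‖z‖ → F φ z = 0) (b : ℝ) (hb : 0 ≤ b) :
    ∫ φ in (0 : ℝ)..b, ∫ z, F φ z = ∫ z, ∫ φ in (0 : ℝ)..b, F φ z := by
  refine intervalIntegral_integral_swap ?_
  rw [uIoc_of_le hb]
  have h : (volume.restrict (Ioc 0 b)).prod (volume : Measure ℂ) =
      ((volume : Measure ℝ).prod volume).restrict (Ioc 0 b ×ˢ univ) := by
    rw [← Measure.prod_restrict, Measure.restrict_univ]
  rw [h]
  have h1 : IntegrableOn (Function.uncurry F) (Icc 0 b ×ˢ Metric.closedBall (0 : ℂ) R)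
      ((volume : Measure ℝ).prod volume) :=
    hF.continuousOn.integrableOn_compact (isCompact_Icc.prod (isCompact_closedBall _ _))
  refine IntegrableOn.of_forall_sdiff_eq_zero h1 (measurableSet_Ioc.prod MeasurableSet.univ)
    fun p hp => hR _ _ ?_
  by_contra hlt
  exact hp.2 ⟨Ioc_subset_Icc_self hp.1.1, by simpa using (not_le.1 hlt).le⟩

lemma continuous_integral_of_eq_zero (hF : Continuous (Function.uncurry F))
    (hR : ∀ φ z, R ≤ ‖z‖ → F φ z = 0) : Continuous fun φ => ∫ z, F φ z := by
  have := continuous_parametric_integral_of_continuous (μ := (volume : Measure ℂ)) hF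
    (isCompact_closedBall (0 : ℂ) R)
  refine this.congr fun φ => ?_
  refine setIntegral_eq_integral_of_forall_compl_eq_zero fun z hz => hR _ _ ?_
  simpa using (not_le.1 (by simpa using hz : ¬ ‖z‖ ≤ R)).le

/-- The kernel `exp (-2πi ⟪z, ξ⟫)` of the Fourier transform on `ℂ = ℝ²`. -/
def planeWave (ξ z : ℂ) : ℂ := exp (-(2 * Real.pi * ⟪z, ξ⟫ : ℝ) * I)

lemma continuous_planeWave (ξ : ℂ) : Continuous (planeWave ξ) := by
  unfold planeWave; fun_prop

lemma hasLineDerivAt_planeWave (ξ z l : ℂ) :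
    HasLineDerivAt ℝ (planeWave ξ) (-(2 * Real.pi * ⟪l, ξ⟫ : ℝ) * I * planeWave ξ z) z l := by
  have h1 : HasDerivAt (fun t : ℝ => -(2 * Real.pi * ⟪z + t • l, ξ⟫))
      (-(2 * Real.pi * ⟪l, ξ⟫)) 0 := by
    have : (fun t : ℝ => -(2 * Real.pi * ⟪z + t • l, ξ⟫)) =
        fun t : ℝ => -(2 * Real.pi * ⟪z, ξ⟫) + t * (-(2 * Real.pi * ⟪l, ξ⟫)) := by
      ext t; rw [inner_add_left, real_inner_smul_left]; ring
    rw [this]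
    simpa using ((hasDerivAt_id (0 : ℝ)).mul_const (-(2 * Real.pi * ⟪l, ξ⟫))).const_add
      (-(2 * Real.pi * ⟪z, ξ⟫))
  have h2 := (h1.ofReal_comp.mul_const I).cexp
  unfold HasLineDerivAt
  refine (h2.congr_deriv ?_).congr_of_eventuallyEq (Eventually.of_forall fun t => ?_)
  · simp only [planeWave, zero_smul, add_zero]; push_cast; ring
  · simp only [planeWave]; push_cast; ring

lemma integral_planeWave_mul_lineDeriv {f g : ℂ → ℂ} (hf : Continuous f) (hg : Continuous g)
    (hfR : ∀ z, R ≤ ‖z‖ → f z = 0) (hgR : ∀ z, R ≤ ‖z‖ → g z = 0) {l : ℂ}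
    (hd : ∀ z, HasLineDerivAt ℝ f (g z) z l) (ξ : ℂ) :
    ∫ z, planeWave ξ z * g z = (2 * Real.pi * ⟪l, ξ⟫ : ℝ) * I * ∫ z, planeWave ξ z * f z := by
  have hp := continuous_planeWave ξ
  have h := integral_bilinear_hasLineDerivAt_right_eq_neg_left_of_integrable (μ := volume)
    (f := planeWave ξ) (f' := fun z => -(2 * Real.pi * ⟪l, ξ⟫ : ℝ) * I * planeWave ξ z)
    (g := f) (g' := g) (v := l) (B := ContinuousLinearMap.mul ℝ ℂ)
    (integrable_of_eq_zero (R := R) (by simp only [ContinuousLinearMap.mul_apply']; fun_prop)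
      (fun z hz => by simp [hfR z hz]))
    (integrable_of_eq_zero (R := R) (by simp only [ContinuousLinearMap.mul_apply']; fun_prop)
      (fun z hz => by simp [hgR z hz]))
    (integrable_of_eq_zero (R := R) (by simp only [ContinuousLinearMap.mul_apply']; fun_prop)
      (fun z hz => by simp [hfR z hz]))
    (fun z _ => hasLineDerivAt_planeWave ξ z l) (fun z _ => hd z)
  simp only [ContinuousLinearMap.mul_apply'] at h
  rw [h, ← integral_neg, ← integral_const_mul]
  congr 1; ext z; ring

/-- `⟪l, ξ⟫` has only the Fourier modes `1` and `-1` in `l`. -/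
lemma inner_exp_mul_I (φ : ℝ) (ξ : ℂ) :
    ((⟪exp (φ * I), ξ⟫ : ℝ) : ℂ) * exp (φ * I) = (conj ξ * exp (φ * I) ^ 2 + ξ) / 2 := by
  have h1 : exp (φ * I) * conj (exp (φ * I)) = 1 := by
    rw [Complex.mul_conj, Complex.normSq_eq_norm_sq, norm_exp_ofReal_mul_I]; simp
  rw [Complex.inner, Complex.re_eq_add_conj, map_mul, conj_conj]
  linear_combination (ξ / 2) * h1

lemma eq_zero_of_fourier_eq_zero {f : ℂ → ℂ} (hf : Continuous f) (hR : ∀ z, R ≤ ‖z‖ → f z = 0)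
    (h : ∀ ξ, ξ ≠ 0 → ∫ z, planeWave ξ z * f z = 0) (z : ℂ) : f z = 0 := by
  have hF : ∀ ξ, ξ ≠ 0 → 𝓕 f ξ = 0 := by
    intro ξ hξ
    rw [Real.fourier_eq', ← h ξ hξ]
    congr 1; ext z
    rw [planeWave, smul_eq_mul]
    push_cast
    congr 3; ring
  have hae : 𝓕 f =ᵐ[volume] 0 := by
    filter_upwards [compl_mem_ae_iff.2 (measure_singleton (μ := volume) (0 : ℂ))] with ξ hξ
    exact hF ξ hξ
  have hinv := hf.fourierInv_fourier_eq (integrable_of_eq_zero hf hR)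
    ((integrable_zero _ _ _).congr hae.symm)
  rw [← hinv, Real.fourierInv_eq']
  refine integral_eq_zero_of_ae ?_
  filter_upwards [hae] with ξ hξ
  simp [hξ]

/-- Let `v` have compact support and `l · ∇v = k`, where `l = exp (i φ)`. If `k` has no Fourier
modes in `φ` of index at most `-2`, then `v` has no modes of negative index. Indeed, the modes
`cₙ` of the Fourier transform of `v` in `z`, of index `-n`, satisfy
`conj ξ * cₙ₊₂ + ξ * cₙ = 0`, hence `|cₙ|` is constant along each parity class, and it tends to
zero by the Riemann-Lebesgue lemma. -/
lemma integral_mul_exp_pow_eq_zero_of_hasLineDerivAt (hk : Continuous (Function.uncurry k))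
    (hv : Continuous (Function.uncurry v)) (hkR : ∀ φ z, R ≤ ‖z‖ → k φ z = 0)
    (hvR : ∀ φ z, R ≤ ‖z‖ → v φ z = 0)
    (hd : ∀ φ z, HasLineDerivAt ℝ (v φ) (k φ z) z (exp (φ * I)))
    (hmodes : ∀ n ≥ 2, ∀ z, ∫ φ in (0 : ℝ)..2 * Real.pi, k φ z * exp (φ * I) ^ n = 0) :
    ∀ n ≥ 1, ∀ z, ∫ φ in (0 : ℝ)..2 * Real.pi, v φ z * exp (φ * I) ^ n = 0 := by
  have hpi : (0 : ℝ) ≤ 2 * Real.pi := by positivity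
  have hpw := continuous_planeWave
  set V : ℂ → ℝ → ℂ := fun ξ φ => ∫ z, planeWave ξ z * v φ z with hV
  have hVc : ∀ ξ, Continuous (V ξ) := fun ξ =>
    continuous_integral_of_eq_zero (F := fun φ z => planeWave ξ z * v φ z) (R := R)
      (((hpw ξ).comp continuous_snd).mul hv) (fun φ z hz => by simp [hvR φ z hz])
  have hKV : ∀ ξ φ, ∫ z, planeWave ξ z * k φ z =
      (2 * Real.pi * ⟪exp (φ * I), ξ⟫ : ℝ) * I * V ξ φ := fun ξ φ =>
    integral_planeWave_mul_lineDeriv (R := R) (by fun_prop) (by fun_prop) (hvR φ) (hkR φ) (hd φ) ξ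
  have hrec : ∀ ξ : ℂ, ∀ n ≥ 1,
      conj ξ * (∫ φ in (0 : ℝ)..2 * Real.pi, V ξ φ * exp (φ * I) ^ (n + 2))
      + ξ * (∫ φ in (0 : ℝ)..2 * Real.pi, V ξ φ * exp (φ * I) ^ n) = 0 := by
    intro ξ n hn
    have h0 : ∫ φ in (0 : ℝ)..2 * Real.pi,
        (∫ z, planeWave ξ z * k φ z * exp (φ * I) ^ (n + 1)) = 0 := by
      rw [integral_interval_swap (F := fun φ z => planeWave ξ z * k φ z * exp (φ * I) ^ (n + 1))
        (R := R) ((((hpw ξ).comp continuous_snd).mul hk).mul (by fun_prop))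
        (fun φ z hz => by simp [hkR φ z hz]) _ hpi]
      simp only [mul_assoc, intervalIntegral.integral_const_mul, hmodes (n + 1) (by omega),
        mul_zero,
        integral_zero]
    simp only [integral_mul_const, hKV] at h0
    have hc := hVc ξ
    rw [← intervalIntegral.integral_const_mul, ← intervalIntegral.integral_const_mul,
      ← intervalIntegral.integral_add (Continuous.intervalIntegrable (by fun_prop) _ _)
        (Continuous.intervalIntegrable (by fun_prop) _ _)]
    rw [← mul_zero (((Real.pi : ℂ) * I)⁻¹), ← h0, ← intervalIntegral.integral_const_mul]
    congr 1; ext φ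
    have hpi0 : (Real.pi : ℂ) ≠ 0 := by exact_mod_cast Real.pi_ne_zero
    have := inner_exp_mul_I φ ξ
    have hI := Complex.I_ne_zero
    rw [mul_inv]
    push_cast
    field_simp
    rw [pow_succ (exp (φ * I)) n]
    linear_combination (-2 * V ξ φ * exp (φ * I) ^ n) * this
  have hc0 : ∀ ξ : ℂ, ξ ≠ 0 → ∀ n ≥ 1,
      ∫ φ in (0 : ℝ)..2 * Real.pi, V ξ φ * exp (φ * I) ^ n = 0 := by
    intro ξ hξ n hn
    refine eq_zero_of_norm_add_two_eq
      (c := fun n => ∫ φ in (0 : ℝ)..2 * Real.pi, V ξ φ * exp (φ * I) ^ n) (fun m hm => ?_)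
      tendsto_integral_mul_exp_pow hn
    have := congrArg norm (eq_neg_of_add_eq_zero_left (hrec ξ m hm))
    rw [norm_neg, norm_mul, norm_mul, Complex.norm_conj] at this
    exact mul_left_cancel₀ (norm_ne_zero_iff.2 hξ) this
  intro n hn
  refine eq_zero_of_fourier_eq_zero (R := R) ?_ ?_ ?_
  · refine intervalIntegral.continuous_parametric_intervalIntegral_of_continuous'
      (f := fun z φ => v φ z * exp (φ * I) ^ n) ?_ _ _
    exact (hv.comp continuous_swap).mul (by fun_prop)
  · intro z hz
    simp [hvR _ z hz]
  · intro ξ hξ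
    have h := integral_interval_swap (F := fun φ z => planeWave ξ z * v φ z * exp (φ * I) ^ n)
        (R := R) ((((hpw ξ).comp continuous_snd).mul hv).mul (by fun_prop))
        (fun φ z hz => by simp [hvR φ z hz]) _ hpi
    simp only [integral_mul_const] at h
    simp only [mul_assoc, intervalIntegral.integral_const_mul] at h
    rw [← h]
    exact hc0 ξ hξ n hn

end modes

section core
open MeasureTheory ComplexConjugate Complex

variable {a h₀ : ℂ → ℝ} {h₁ : ℂ → ℂ} {L : NNReal} {R : ℝ}

lemma integral_exp_pow_eq_zero {n : ℕ} (hn : 1 ≤ n) :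
    ∫ φ in (0 : ℝ)..2 * Real.pi, exp (φ * I) ^ n = 0 := by
  have hc : (n : ℂ) * I ≠ 0 := mul_ne_zero (by exact_mod_cast (by omega : n ≠ 0)) I_ne_zero
  have : ∀ φ : ℝ, exp (φ * I) ^ n = exp ((n * I) * φ) := fun φ => by
    rw [← Complex.exp_nat_mul]; congr 1; ring
  simp only [this]
  rw [integral_exp_mul_complex hc]
  have e : (n : ℂ) * I * ((2 * Real.pi : ℝ) : ℂ) = n * (2 * Real.pi * I) := by push_cast; ring
  rw [e, Complex.exp_nat_mul_two_pi_mul_I]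
  simp

/-- The right-hand side `h₀ - l · h₁` of the transport equation; the vector field `h₁` is
complex-valued, and `(conj l * h₁ z).re` is its inner product with `l`. -/
def sourceTerm (h₀ : ℂ → ℝ) (h₁ : ℂ → ℂ) (z l : ℂ) : ℝ := h₀ z - (conj l * h₁ z).re

lemma integral_sourceTerm_mul_exp_pow (h₀ : ℂ → ℝ) (h₁ : ℂ → ℂ) (z : ℂ) {n : ℕ} (hn : 2 ≤ n) :
    ∫ φ in (0 : ℝ)..2 * Real.pi, (sourceTerm h₀ h₁ z (exp (φ * I)) : ℂ) * exp (φ * I) ^ n = 0 := by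
  obtain ⟨m, rfl⟩ : ∃ m, n = m + 2 := ⟨n - 2, by omega⟩
  have e : ∀ φ : ℝ, (sourceTerm h₀ h₁ z (exp (φ * I)) : ℂ) * exp (φ * I) ^ (m + 2) =
      h₀ z * exp (φ * I) ^ (m + 2) + (-(h₁ z) / 2 * exp (φ * I) ^ (m + 1) +
        -(conj (h₁ z)) / 2 * exp (φ * I) ^ (m + 3)) := by
    intro φ
    have h1 : exp (φ * I) * conj (exp (φ * I)) = 1 := by
      rw [Complex.mul_conj, Complex.normSq_eq_norm_sq, norm_exp_ofReal_mul_I]; simp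
    rw [sourceTerm, Complex.ofReal_sub, Complex.re_eq_add_conj, map_mul, conj_conj]
    linear_combination (-(h₁ z) / 2 * exp (φ * I) ^ (m + 1)) * h1
  simp only [e]
  have hi : ∀ (c : ℂ) (j : ℕ), IntervalIntegrable (fun φ : ℝ => c * exp (φ * I) ^ j) volume 0
      (2 * Real.pi) := fun c j => Continuous.intervalIntegrable (by fun_prop) _ _
  rw [intervalIntegral.integral_add (hi _ _) ((hi _ _).add (hi _ _)),
    intervalIntegral.integral_add (hi _ _) (hi _ _)]
  simp only [intervalIntegral.integral_const_mul]
  rw [integral_exp_pow_eq_zero (by omega), integral_exp_pow_eq_zero (by omega),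
    integral_exp_pow_eq_zero (by omega)]
  simp

/-- The solution `u` of `l · ∇u + a u = h₀ - l · h₁` that vanishes at the beginning of every line
of direction `l`. -/
def transportSol (a : ℂ → ℝ) (h₀ : ℂ → ℝ) (h₁ : ℂ → ℂ) (z l : ℂ) : ℝ :=
  Real.exp (-halfBeamDiff a z l) *
    rayIntegral (fun y => sourceTerm h₀ h₁ y l * Real.exp (halfBeamDiff a y l)) z l

lemma continuous_sourceTerm (h₀c : Continuous h₀) (h₁c : Continuous h₁) :
    Continuous fun p : ℂ × ℝ => sourceTerm h₀ h₁ p.1 (exp (p.2 * I)) := by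
  unfold sourceTerm; fun_prop

lemma exists_eq_exp_mul_I {l : ℂ} (hl : ‖l‖ = 1) : ∃ φ : ℝ, l = exp (φ * I) := by
  refine ⟨arg l, ?_⟩
  have := Complex.norm_mul_exp_arg_mul_I l
  rw [hl] at this; simpa using this.symm

lemma continuous_weighted (ha : LipschitzWith L a) (haR : ∀ y, R ≤ ‖y‖ → a y = 0)
    (h₀c : Continuous h₀) (h₁c : Continuous h₁) {l : ℂ} (hl : ‖l‖ = 1) :
    Continuous fun y => sourceTerm h₀ h₁ y l * Real.exp (halfBeamDiff a y l) := by
  obtain ⟨φ, rfl⟩ := exists_eq_exp_mul_I hl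
  have h1 := (continuous_sourceTerm h₀c h₁c).comp (by fun_prop : Continuous fun z : ℂ => (z, φ))
  have h2 := (continuous_halfBeamDiff ha.continuous haR).comp
    (by fun_prop : Continuous fun z : ℂ => (z, φ))
  exact h1.mul (Real.continuous_exp.comp h2)

lemma hasDerivAt_transportSol (ha : LipschitzWith L a) (haR : ∀ y, R ≤ ‖y‖ → a y = 0)
    (h₀c : Continuous h₀) (h₁c : Continuous h₁) (h₀R : ∀ y, R ≤ ‖y‖ → h₀ y = 0)
    (h₁R : ∀ y, R ≤ ‖y‖ → h₁ y = 0) {l : ℂ} (hl : ‖l‖ = 1) (z : ℂ) :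
    HasDerivAt (fun τ : ℝ => transportSol a h₀ h₁ (z + τ * l) l)
      (sourceTerm h₀ h₁ z l - a z * transportSol a h₀ h₁ z l) 0 := by
  have hc := continuous_weighted ha haR h₀c h₁c hl
  have h1 := hasDerivAt_rayIntegral hc (R := R)
    (fun y hy => by simp [sourceTerm, h₀R y hy, h₁R y hy]) hl z 0
  have h2 := (hasDerivAt_halfBeamDiff ha.continuous haR hl z 0).neg.exp
  refine (h2.mul h1).congr_deriv ?_
  simp only [ofReal_zero, zero_mul, add_zero, transportSol]
  have : Real.exp (-halfBeamDiff a z l) * Real.exp (halfBeamDiff a z l) = 1 := by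
    rw [← Real.exp_add]; simp
  simp only [Pi.neg_apply, ofReal_zero, zero_mul, add_zero]
  linear_combination (sourceTerm h₀ h₁ z l) * this

/-- If the attenuated transform of the source vanishes on every line, then the solution of the
transport equation does not depend on the direction. -/
lemma transportSol_eq (ha : LipschitzWith L a) (haR : ∀ y, R ≤ ‖y‖ → a y = 0)
    (h₀c : Continuous h₀) (h₁c : Continuous h₁) (h₀R : ∀ y, R ≤ ‖y‖ → h₀ y = 0)
    (h₁R : ∀ y, R ≤ ‖y‖ → h₁ y = 0)
    (hzero : ∀ z l : ℂ, ‖l‖ = 1 → ∫ t : ℝ, sourceTerm h₀ h₁ (z + t * l) l *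
      Real.exp (halfBeamDiff a (z + t * l) l) = 0) {l l' : ℂ} (hl : ‖l‖ = 1) (hl' : ‖l'‖ = 1)
    (z : ℂ) : transportSol a h₀ h₁ z l = transportSol a h₀ h₁ z l' := by
  set k : ℝ → ℂ → ℂ := fun φ z => sourceTerm h₀ h₁ z (exp (φ * I)) *
    exp (holFactor a z (exp (φ * I))) with hk
  set v : ℝ → ℂ → ℂ := fun φ z => rayIntegral (k φ) z (exp (φ * I)) with hv
  have hn := norm_exp_ofReal_mul_I
  have hkc : Continuous (Function.uncurry k) := by
    have h1 := (continuous_sourceTerm h₀c h₁c).comp continuous_swap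
    have h2 := (continuous_holFactor ha haR).comp continuous_swap
    exact (continuous_ofReal.comp h1).mul (continuous_exp.comp h2)
  have hkR : ∀ φ z, R ≤ ‖z‖ → k φ z = 0 := fun φ z hz => by
    simp [hk, sourceTerm, h₀R z hz, h₁R z hz]
  have hkc' : ∀ φ, Continuous (k φ) := fun φ => by fun_prop
  have hvc : Continuous (Function.uncurry v) :=
    continuous_rayIntegral (X := ℝ × ℂ) (k := fun p => k p.1)
      (hkc.comp (by fun_prop : Continuous fun q : (ℝ × ℂ) × ℂ => (q.1.1, q.2)))
      (fun p => hkR p.1) continuous_snd (by fun_prop) (fun p => hn p.1)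
  -- the imaginary part of the integrating factor is constant along the lines
  have hline : ∀ (φ : ℝ) (z : ℂ) (t : ℝ), k φ (z + t * exp (φ * I)) =
      ((sourceTerm h₀ h₁ (z + t * exp (φ * I)) (exp (φ * I)) *
      Real.exp (halfBeamDiff a (z + t * exp (φ * I)) (exp (φ * I))) : ℝ) : ℂ) *
      exp (-((radonHilbert a z (exp (φ * I)) / (2 * Real.pi) : ℝ) * I)) := by
    intro φ z t
    simp only [hk, holFactor, radonHilbert_add_mul]
    rw [sub_eq_add_neg, Complex.exp_add]
    push_cast; ring
  have hvR : ∀ φ z, R ≤ ‖z‖ → v φ z = 0 := by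
    intro φ z hz
    refine rayIntegral_eq_zero (hkc' φ) (hkR φ) (hn φ) hz ?_
    simp only [hline]
    rw [integral_mul_const, integral_complex_ofReal, hzero z _ (hn φ)]
    simp
  have hvu : ∀ (φ : ℝ) (z : ℂ), (transportSol a h₀ h₁ z (exp (φ * I)) : ℂ) =
      exp (-holFactor a z (exp (φ * I))) * v φ z := by
    intro φ z
    simp only [hv, rayIntegral, hline]
    rw [integral_mul_const, integral_complex_ofReal, transportSol, rayIntegral, holFactor, neg_sub,
      sub_eq_neg_add, Complex.exp_add]
    have : exp ((radonHilbert a z (exp (φ * I)) / (2 * Real.pi) : ℝ) * I) *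
      exp (-((radonHilbert a z (exp (φ * I)) / (2 * Real.pi) : ℝ) * I)) = 1 := by
      rw [← Complex.exp_add]; simp
    push_cast at this ⊢
    linear_combination (-exp (-halfBeamDiff a z (exp (φ * I))) * (∫ t in Iic (0 : ℝ),
      sourceTerm h₀ h₁ (z + t * exp (φ * I)) (exp (φ * I)) *
      Real.exp (halfBeamDiff a (z + t * exp (φ * I)) (exp (φ * I))) : ℝ)) * this
  have hdisc := fun z => exists_norm_discFactor_le_and_tendsto ha haR z
  have hdiff := fun z => differentiableOn_discFactor ha haR z
  have hkm : ∀ n ≥ 2, ∀ z, ∫ φ in (0 : ℝ)..2 * Real.pi, k φ z * exp (φ * I) ^ n = 0 := by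
    intro n hn2 z
    obtain ⟨⟨C, hC⟩, hlim⟩ := hdisc z
    have := integral_mul_boundaryValue_eq_zero (G := fun μ => exp (discFactor a z μ))
      (hdiff z).cexp (C := Real.exp C)
      (fun μ hμ => by
        rw [Complex.norm_exp]
        exact Real.exp_le_exp.2 ((re_le_norm _).trans (hC μ hμ)))
      (fun φ => (hlim _ (hn φ)).cexp)
      (g := fun φ => (sourceTerm h₀ h₁ z (exp (φ * I)) : ℂ))
      (continuous_ofReal.comp ((continuous_sourceTerm h₀c h₁c).comp
        (by fun_prop : Continuous fun φ : ℝ => (z, φ)))) (N := 2)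
      (fun n hn => integral_sourceTerm_mul_exp_pow h₀ h₁ z hn) n hn2
    rw [← this]
    congr 1; ext φ; simp only [hk]; ring
  have hd : ∀ φ z, HasLineDerivAt ℝ (v φ) (k φ z) z (exp (φ * I)) := by
    intro φ z
    have := hasDerivAt_rayIntegral (hkc' φ) (hkR φ) (hn φ) z 0
    simpa [HasLineDerivAt, hv] using this
  have hvm := integral_mul_exp_pow_eq_zero_of_hasLineDerivAt hkc hvc hkR hvR hd hkm
  have hum : ∀ n : ℕ, 1 ≤ n → ∫ φ in (0 : ℝ)..2 * Real.pi,
      (transportSol a h₀ h₁ z (exp (φ * I)) : ℂ) * exp (φ * I) ^ n = 0 := by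
    intro n hn1
    obtain ⟨⟨C, hC⟩, hlim⟩ := hdisc z
    have := integral_mul_boundaryValue_eq_zero (G := fun μ => exp (-discFactor a z μ))
      (hdiff z).neg.cexp (C := Real.exp C)
      (fun μ hμ => by
        rw [Complex.norm_exp]
        exact Real.exp_le_exp.2 ((re_le_norm _).trans (by rw [norm_neg]; exact hC μ hμ)))
      (fun φ => (hlim _ (hn φ)).neg.cexp)
      (g := fun φ => v φ z) (by fun_prop) (N := 1)
      (fun n hn => hvm n hn z) n hn1
    rw [← this]
    congr 1; ext φ; rw [hvu]
  have huc : Continuous fun φ : ℝ => transportSol a h₀ h₁ z (exp (φ * I)) := by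
    have h1 : Continuous fun φ : ℝ => exp (-holFactor a z (exp (φ * I))) * v φ z := by
      have := (continuous_holFactor ha haR).comp (by fun_prop : Continuous fun φ : ℝ => (z, φ))
      exact (continuous_exp.comp this.neg).mul (by fun_prop)
    refine (continuous_re.comp h1).congr fun φ => ?_
    simp only [Function.comp, ← hvu, ofReal_re]
  obtain ⟨φ, rfl⟩ := exists_eq_exp_mul_I hl
  obtain ⟨ψ, rfl⟩ := exists_eq_exp_mul_I hl'
  refine eq_of_integral_mul_exp_pow_eq_zero huc (fun φ => ?_) hum φ ψ
  have : exp ((φ + 2 * Real.pi : ℝ) * I) = exp (φ * I) := by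
    push_cast
    rw [add_mul, Complex.exp_add, Complex.exp_two_pi_mul_I, mul_one]
  simp only [this]

/-- Injectivity, up to the natural gauge, of the attenuated transform of a function and a vector
field in the plane: if the transform of `h₀ - l · h₁` vanishes, then `h₀ = a p` and `h₁ = -∇p`. -/
theorem exists_potential (ha : LipschitzWith L a) (haR : ∀ y, R ≤ ‖y‖ → a y = 0)
    (h₀c : Continuous h₀) (h₁c : Continuous h₁) (h₀R : ∀ y, R ≤ ‖y‖ → h₀ y = 0)
    (h₁R : ∀ y, R ≤ ‖y‖ → h₁ y = 0)
    (hzero : ∀ z l : ℂ, ‖l‖ = 1 → ∫ t : ℝ, sourceTerm h₀ h₁ (z + t * l) l *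
      Real.exp (halfBeamDiff a (z + t * l) l) = 0) :
    ∃ p : ℂ → ℝ, (∀ z, h₀ z = a z * p z) ∧
      ∀ z l, ‖l‖ = 1 → HasDerivAt (fun τ : ℝ => p (z + τ * l)) (-(conj l * h₁ z).re) 0 := by
  set p : ℂ → ℝ := fun z => transportSol a h₀ h₁ z 1 with hp
  have hd : ∀ z l, ‖l‖ = 1 → HasDerivAt (fun τ : ℝ => p (z + τ * l))
      (sourceTerm h₀ h₁ z l - a z * p z) 0 := by
    intro z l hl
    have := hasDerivAt_transportSol ha haR h₀c h₁c h₀R h₁R hl z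
    have e : ∀ w, transportSol a h₀ h₁ w l = p w := fun w =>
      transportSol_eq ha haR h₀c h₁c h₀R h₁R hzero hl (by simp) w
    simpa only [e] using this
  have h0 : ∀ z, h₀ z = a z * p z := by
    intro z
    have h1 := hd z 1 (by simp)
    have h2 := (hd z (-1) (by simp)).scomp_of_eq (0 : ℝ) (hasDerivAt_neg (0 : ℝ)) (by simp)
    have h3 := h1.unique (h2.congr_of_eventuallyEq (Eventually.of_forall fun τ => by simp))
    simp only [sourceTerm, map_neg, map_one, one_mul, neg_mul, neg_re, smul_eq_mul] at h3
    linarith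
  refine ⟨p, h0, fun z l hl => (hd z l hl).congr_deriv ?_⟩
  rw [sourceTerm, ← h0 z]; ring

end core

/-! ### Chords of a strictly convex domain -/

section chord
open MeasureTheory

variable {Ω : Set Plane} {x θ : Plane}

lemma isGreatest_exitDist (hb : Bornology.IsBounded Ω) (hx : x ∈ closure Ω) (hθ : ‖θ‖ = 1) :
    IsGreatest {t : ℝ | 0 ≤ t ∧ x + t • θ ∈ closure Ω} (exitDist Ω x θ) := by
  have hne : {t : ℝ | 0 ≤ t ∧ x + t • θ ∈ closure Ω}.Nonempty := ⟨0, le_rfl, by simpa using hx⟩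
  obtain ⟨M, hM⟩ := hb.closure.exists_norm_le
  have hbdd : BddAbove {t : ℝ | 0 ≤ t ∧ x + t • θ ∈ closure Ω} := by
    refine ⟨M + ‖x‖, fun t ht => ?_⟩
    have h1 := hM _ ht.2
    have h2 := norm_sub_norm_le (t • θ) (-x)
    rw [norm_neg, sub_neg_eq_add, add_comm (t • θ), norm_smul, hθ, mul_one, Real.norm_eq_abs,
      abs_of_nonneg ht.1] at h2
    linarith
  have hcl : IsClosed {t : ℝ | 0 ≤ t ∧ x + t • θ ∈ closure Ω} :=
    (isClosed_le continuous_const continuous_id).inter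
      (isClosed_closure.preimage (by fun_prop : Continuous fun t : ℝ => x + t • θ))
  exact ⟨hcl.csSup_mem hne hbdd, fun t ht => le_csSup hbdd ht⟩

lemma mem_closure_chord_iff (hb : Bornology.IsBounded Ω) (hc : Convex ℝ Ω) (hx : x ∈ closure Ω)
    (hθ : ‖θ‖ = 1) (t : ℝ) :
    x + t • θ ∈ closure Ω ↔ t ∈ Icc (-exitDist Ω x (-θ)) (exitDist Ω x θ) := by
  have h1 := isGreatest_exitDist hb hx hθ
  have h2 := isGreatest_exitDist hb hx (θ := -θ) (by rwa [norm_neg])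
  constructor
  · intro h
    rcases le_total 0 t with ht | ht
    · exact ⟨by linarith [h2.1.1], h1.2 ⟨ht, h⟩⟩
    · have := h2.2 (show -t ∈ _ from ⟨by linarith, by simpa using h⟩)
      exact ⟨by linarith, by linarith [h1.1.1]⟩
  · intro h
    have hmem : ∀ y : Plane, ∀ T : ℝ, ∀ η : Plane, x + T • η ∈ closure Ω → ∀ s, 0 ≤ s → s ≤ T →
        x + s • η ∈ closure Ω := by
      intro y T η hT s hs0 hsT
      rcases hs0.eq_or_lt with rfl | hs
      · simpa using hx
      have hT0 : 0 < T := hs.trans_le hsT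
      have := hc.closure.add_smul_sub_mem hx hT (t := s / T) ⟨by positivity, by
        rw [div_le_one hT0]; exact hsT⟩
      rwa [add_sub_cancel_left, smul_smul, div_mul_cancel₀ _ hT0.ne'] at this
    rcases le_total 0 t with ht | ht
    · exact hmem x _ _ h1.1.2 t ht h.2
    · have := hmem x _ _ h2.1.2 (-t) (by linarith) (by linarith [h.1])
      simpa using this

/-- By strict convexity, the open chord lies in `Ω`. -/
lemma mem_chord_iff (ho : IsOpen Ω) (hb : Bornology.IsBounded Ω) (hc : Convex ℝ Ω)
    (hs : StrictConvex ℝ (closure Ω)) (hne : Ω.Nonempty) (hx : x ∈ closure Ω)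
    (hθ : ‖θ‖ = 1) (t : ℝ) :
    x + t • θ ∈ Ω ↔ t ∈ Ioo (-exitDist Ω x (-θ)) (exitDist Ω x θ) := by
  have hiff := mem_closure_chord_iff hb hc hx hθ
  set S := exitDist Ω x (-θ)
  set T := exitDist Ω x θ
  constructor
  · intro h
    have hnhds : Icc (-S) T ∈ 𝓝 t := by
      have hcont : Continuous fun s : ℝ => x + s • θ := by fun_prop
      filter_upwards [hcont.continuousAt.preimage_mem_nhds (ho.mem_nhds h)] with s hs
      exact (hiff s).1 (subset_closure hs)
    rw [← interior_Icc]; exact mem_interior_iff_mem_nhds.2 hnhds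
  · intro h
    have hST : -S < T := h.1.trans h.2
    have e1 : x + (-S) • θ ∈ closure Ω := (hiff _).2 ⟨le_rfl, hST.le⟩
    have e2 : x + T • θ ∈ closure Ω := (hiff _).2 ⟨hST.le, le_rfl⟩
    have hθ0 : θ ≠ 0 := by rw [← norm_pos_iff, hθ]; norm_num
    have hne' : x + (-S) • θ ≠ x + T • θ := by
      intro h'
      exact hST.ne (smul_left_injective ℝ hθ0 (add_left_cancel h'))
    have hseg : x + t • θ ∈ openSegment ℝ (x + (-S) • θ) (x + T • θ) := by
      have hd : 0 < T + S := by linarith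
      refine ⟨(T - t) / (T + S), (t + S) / (T + S), div_pos (by linarith [h.2]) hd,
        div_pos (by linarith [h.1]) hd, by field_simp; ring, ?_⟩
      have e : (T - t) / (T + S) + (t + S) / (T + S) = 1 := by field_simp; ring
      have e' : (T - t) / (T + S) * (-S) + (t + S) / (T + S) * T = t := by field_simp; ring
      calc _ = ((T - t) / (T + S) + (t + S) / (T + S)) • x +
            ((T - t) / (T + S) * (-S) + (t + S) / (T + S) * T) • θ := by module
        _ = _ := by rw [e, e', one_smul]
    have := hs.openSegment_subset e1 e2 hne' hseg
    rwa [hc.interior_closure_eq_interior_of_nonempty_interior (by rwa [ho.interior_eq]),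
      ho.interior_eq] at this

lemma exitDist_add_smul (hb : Bornology.IsBounded Ω) (hc : Convex ℝ Ω) (hx : x ∈ closure Ω)
    (hθ : ‖θ‖ = 1) {t : ℝ} (ht : t ∈ Icc (-exitDist Ω x (-θ)) (exitDist Ω x θ)) :
    exitDist Ω (x + t • θ) θ = exitDist Ω x θ - t := by
  have hiff := mem_closure_chord_iff hb hc hx hθ
  have e : ∀ u : ℝ, x + t • θ + u • θ = x + (t + u) • θ := fun u => by module
  refine IsGreatest.csSup_eq ⟨⟨by linarith [ht.2], ?_⟩, fun u hu => ?_⟩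
  · rw [e, hiff]; exact ⟨by linarith [ht.1, ht.2], by linarith⟩
  · have := hu.2
    rw [e, hiff] at this
    linarith [this.2]

lemma exitDist_add_smul_neg (hb : Bornology.IsBounded Ω) (hc : Convex ℝ Ω) (hx : x ∈ closure Ω)
    (hθ : ‖θ‖ = 1) {t : ℝ} (ht : t ∈ Icc (-exitDist Ω x (-θ)) (exitDist Ω x θ)) :
    exitDist Ω (x + t • θ) (-θ) = exitDist Ω x (-θ) + t := by
  have := exitDist_add_smul hb hc hx (θ := -θ) (by rwa [norm_neg]) (t := -t)
    ⟨by rw [neg_neg]; linarith [ht.2], by linarith [ht.1]⟩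
  rw [neg_smul_neg] at this
  rw [this]; ring

lemma exitDist_nonneg (hb : Bornology.IsBounded Ω) (hx : x ∈ closure Ω) (hθ : ‖θ‖ = 1) :
    0 ≤ exitDist Ω x θ := (isGreatest_exitDist hb hx hθ).1.1

lemma beam_add_smul (hb : Bornology.IsBounded Ω) (hc : Convex ℝ Ω) (hx : x ∈ closure Ω)
    (hθ : ‖θ‖ = 1) (a : Plane → ℝ) {t : ℝ}
    (ht : t ∈ Icc (-exitDist Ω x (-θ)) (exitDist Ω x θ)) :
    beam Ω a (x + t • θ) θ = ∫ u in t..exitDist Ω x θ, a (x + u • θ) := by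
  rw [beam, exitDist_add_smul hb hc hx hθ ht]
  have e : ∀ u : ℝ, x + t • θ + u • θ = x + (t + u) • θ := fun u => by module
  simp only [e]
  rw [intervalIntegral.integral_comp_add_left (fun u => a (x + u • θ)) t]
  simp

lemma continuousOn_chord {E : Type*} [TopologicalSpace E] (hb : Bornology.IsBounded Ω)
    (hc : Convex ℝ Ω) (hx : x ∈ closure Ω)
    (hθ : ‖θ‖ = 1) {a : Plane → E} (ha : ContinuousOn a (closure Ω)) :
    ContinuousOn (fun t : ℝ => a (x + t • θ)) (Icc (-exitDist Ω x (-θ)) (exitDist Ω x θ)) :=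
  ha.comp (by fun_prop) fun t ht => (mem_closure_chord_iff hb hc hx hθ t).2 ht

lemma continuousOn_beam_chord (hb : Bornology.IsBounded Ω) (hc : Convex ℝ Ω) (hx : x ∈ closure Ω)
    (hθ : ‖θ‖ = 1) {a : Plane → ℝ} (ha : ContinuousOn a (closure Ω)) :
    ContinuousOn (fun t : ℝ => beam Ω a (x + t • θ) θ)
      (Icc (-exitDist Ω x (-θ)) (exitDist Ω x θ)) := by
  have h1 := continuousOn_chord hb hc hx hθ ha
  have hle : -exitDist Ω x (-θ) ≤ exitDist Ω x θ := by
    have := exitDist_nonneg hb hx hθ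
    have := exitDist_nonneg hb hx (θ := -θ) (by rwa [norm_neg])
    linarith
  have h2 := intervalIntegral.continuousOn_primitive_interval_left (μ := volume)
    (f := fun t : ℝ => a (x + t • θ)) (a := -exitDist Ω x (-θ)) (b := exitDist Ω x θ)
    (by rw [uIcc_of_le hle]; exact h1.integrableOn_Icc)
  rw [uIcc_of_le hle] at h2
  exact h2.congr fun t ht => beam_add_smul hb hc hx hθ a ht

lemma hasDerivAt_beam_chord (hb : Bornology.IsBounded Ω) (hc : Convex ℝ Ω) (hx : x ∈ closure Ω)
    (hθ : ‖θ‖ = 1) {a : Plane → ℝ} (ha : ContinuousOn a (closure Ω)) {t : ℝ}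
    (ht : t ∈ Ioo (-exitDist Ω x (-θ)) (exitDist Ω x θ)) :
    HasDerivAt (fun t : ℝ => beam Ω a (x + t • θ) θ) (-a (x + t • θ)) t := by
  have h1 := continuousOn_chord hb hc hx hθ ha
  have hnhds := Icc_mem_nhds ht.1 ht.2
  have h2 : HasDerivAt (fun t : ℝ => ∫ u in t..exitDist Ω x θ, a (x + u • θ)) (-a (x + t • θ)) t :=
    intervalIntegral.integral_hasDerivAt_left
      (h1.mono (by
        rw [uIcc_of_le ht.2.le]; exact Icc_subset_Icc_left ht.1.le)).intervalIntegrable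
      (h1.stronglyMeasurableAtFilter_nhdsWithin measurableSet_Icc t |>.filter_mono (by
        rw [nhdsWithin_eq_nhds.2 hnhds]))
      (h1.continuousAt hnhds)
  refine h2.congr_of_eventuallyEq ?_
  filter_upwards [hnhds] with s hs using beam_add_smul hb hc hx hθ a hs

end chord

/-! ### Chord integrals, and the Doppler data of a gradient field -/

section chordIntegral
open MeasureTheory

variable {Ω : Set Plane} {x θ : Plane} {q q₁ q₂ : Plane → ℝ} {I : ℝ} {b c : ℝ}

lemma indicator_chord_eq (hmem : ∀ t : ℝ, x + t • θ ∈ Ω ↔ t ∈ Ioo b c) (q : Plane → ℝ) :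
    (fun t : ℝ => Ω.indicator q (x + t • θ)) = (Ioo b c).indicator fun t => q (x + t • θ) := by
  ext t
  by_cases h : t ∈ Ioo b c
  · rw [indicator_of_mem h, indicator_of_mem ((hmem t).2 h)]
  · rw [indicator_of_notMem h, indicator_of_notMem (fun h' => h ((hmem t).1 h'))]

lemma intervalIntegrable_indicator_Ioo {Q : ℝ → ℝ} (hQ : ContinuousOn Q (Ioo b c)) {p r : ℝ}
    (hp : p ∈ Ioo b c) (hr : r ∈ Ioo b c) :
    IntervalIntegrable ((Ioo b c).indicator Q) volume p r := by
  have hsub : uIcc p r ⊆ Ioo b c := ordConnected_Ioo.uIcc_subset hp hr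
  refine ((hQ.mono hsub).congr fun t ht => ?_).intervalIntegrable
  rw [indicator_of_mem (hsub ht)]

lemma integral_indicator_Ioo (Q : ℝ → ℝ) {p r : ℝ} (hp : p ∈ Ioo b c) (hr : r ∈ Ioo b c) :
    ∫ t in p..r, (Ioo b c).indicator Q t = ∫ t in p..r, Q t := by
  refine intervalIntegral.integral_congr fun t ht => ?_
  rw [indicator_of_mem (ordConnected_Ioo.uIcc_subset hp hr ht)]

lemma eventually_mem_Ioo_prod (h : b < c) :
    ∀ᶠ p : ℝ × ℝ in 𝓝[>] b ×ˢ 𝓝[<] c, p.1 ∈ Ioo b c ∧ p.2 ∈ Ioo b c :=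
  (show ∀ᶠ s in 𝓝[>] b, s ∈ Ioo b c from Ioo_mem_nhdsGT h).prod_mk
    (show ∀ᶠ s in 𝓝[<] c, s ∈ Ioo b c from Ioo_mem_nhdsLT h)

/-- Two integrands that differ by the derivative of a function vanishing at both ends of the chord
have the same chord integrals. A degenerate chord is covered: both integrands are then zero. -/
lemma HasChordIntegral.of_hasDerivAt
    (hmem : ∀ t : ℝ, x + t • θ ∈ Ω ↔ t ∈ Ioo (-exitDist Ω x (-θ)) (exitDist Ω x θ))
    (h₁ : ContinuousOn (fun t : ℝ => q₁ (x + t • θ)) (Ioo (-exitDist Ω x (-θ)) (exitDist Ω x θ)))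
    (h₂ : ContinuousOn (fun t : ℝ => q₂ (x + t • θ)) (Ioo (-exitDist Ω x (-θ)) (exitDist Ω x θ)))
    {G : ℝ → ℝ} (hG : ∀ t ∈ Ioo (-exitDist Ω x (-θ)) (exitDist Ω x θ),
      HasDerivAt G (q₂ (x + t • θ) - q₁ (x + t • θ)) t)
    (hl : -exitDist Ω x (-θ) < exitDist Ω x θ → Tendsto G (𝓝[>] (-exitDist Ω x (-θ))) (𝓝 0))
    (hr : -exitDist Ω x (-θ) < exitDist Ω x θ → Tendsto G (𝓝[<] (exitDist Ω x θ)) (𝓝 0))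
    (h : HasChordIntegral Ω q₁ x θ I) : HasChordIntegral Ω q₂ x θ I := by
  unfold HasChordIntegral at h ⊢
  set b := -exitDist Ω x (-θ)
  set c := exitDist Ω x θ
  rw [indicator_chord_eq hmem] at h ⊢
  refine ⟨fun r hr s hs => intervalIntegrable_indicator_Ioo h₂ hr hs, ?_⟩
  rcases lt_or_ge b c with hbc | hbc
  · have hlim := h.2.add (((hr hbc).comp tendsto_snd).sub ((hl hbc).comp tendsto_fst))
    rw [sub_zero, add_zero] at hlim
    refine hlim.congr' ?_
    filter_upwards [eventually_mem_Ioo_prod hbc] with p hp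
    rw [integral_indicator_Ioo _ hp.1 hp.2, integral_indicator_Ioo _ hp.1 hp.2]
    have hsub : uIcc p.1 p.2 ⊆ Ioo b c := ordConnected_Ioo.uIcc_subset hp.1 hp.2
    have i1 := (h₁.mono hsub).intervalIntegrable (μ := volume)
    have i2 := (h₂.mono hsub).intervalIntegrable (μ := volume)
    have := intervalIntegral.integral_eq_sub_of_hasDerivAt (fun t ht => hG t (hsub ht)) (i2.sub i1)
    rw [intervalIntegral.integral_sub i2 i1] at this
    simp only [Function.comp]
    linarith
  · have h0 : ∀ Q : ℝ → ℝ, (Ioo b c).indicator Q = 0 := fun Q => by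
      rw [Ioo_eq_empty hbc.not_gt, indicator_empty]; rfl
    simpa only [h0] using h.2

lemma hasChordIntegral_of_continuousOn
    (hmem : ∀ t : ℝ, x + t • θ ∈ Ω ↔ t ∈ Ioo (-exitDist Ω x (-θ)) (exitDist Ω x θ))
    (hle : -exitDist Ω x (-θ) ≤ exitDist Ω x θ)
    (hq : ContinuousOn (fun t : ℝ => q (x + t • θ))
      (Icc (-exitDist Ω x (-θ)) (exitDist Ω x θ))) :
    HasChordIntegral Ω q x θ (∫ t in -exitDist Ω x (-θ)..exitDist Ω x θ, q (x + t • θ)) := by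
  unfold HasChordIntegral
  set b := -exitDist Ω x (-θ)
  set c := exitDist Ω x θ
  rw [indicator_chord_eq hmem]
  refine ⟨fun r hr s hs =>
    intervalIntegrable_indicator_Ioo (hq.mono Ioo_subset_Icc_self) hr hs, ?_⟩
  rcases hle.lt_or_eq with hbc | hbc
  · have hP := intervalIntegral.continuousOn_primitive_interval (μ := volume)
      (f := fun t : ℝ => q (x + t • θ)) (a := b) (b := c)
      (by rw [uIcc_of_le hle]; exact hq.integrableOn_Icc)
    rw [uIcc_of_le hle] at hP
    have h1 : Tendsto (fun r => ∫ t in b..r, q (x + t • θ)) (𝓝[>] b) (𝓝 0) := by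
      have := (hP b (left_mem_Icc.2 hle)).tendsto
      rw [intervalIntegral.integral_same] at this
      refine this.mono_left ?_
      rw [← nhdsWithin_Ioo_eq_nhdsGT hbc]
      exact nhdsWithin_mono _ Ioo_subset_Icc_self
    have h2 : Tendsto (fun r => ∫ t in b..r, q (x + t • θ)) (𝓝[<] c)
        (𝓝 (∫ t in b..c, q (x + t • θ))) := by
      refine ((hP c (right_mem_Icc.2 hle)).tendsto).mono_left ?_
      rw [← nhdsWithin_Ioo_eq_nhdsLT hbc]
      exact nhdsWithin_mono _ Ioo_subset_Icc_self
    have h3 := (h2.comp tendsto_snd).sub (h1.comp tendsto_fst)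
    rw [sub_zero] at h3
    refine h3.congr' ?_
    filter_upwards [eventually_mem_Ioo_prod hbc] with p hp
    rw [integral_indicator_Ioo _ hp.1 hp.2]
    have hi : ∀ s ∈ Ioo b c, IntervalIntegrable (fun t => q (x + t • θ)) volume b s := fun s hs =>
      (hq.mono (by
        rw [uIcc_of_le hs.1.le]; exact Icc_subset_Icc_right hs.2.le)).intervalIntegrable
    exact intervalIntegral.integral_interval_sub_left (hi _ hp.2) (hi _ hp.1)
  · have h0 : ∀ Q : ℝ → ℝ, (Ioo b c).indicator Q = 0 := fun Q => by
      rw [Ioo_eq_empty hbc.not_lt, indicator_empty]; rfl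
    rw [show ∫ t in b..c, q (x + t • θ) = 0 by rw [hbc, intervalIntegral.integral_same]]
    refine tendsto_const_nhds.congr fun p => ?_
    rw [h0]; exact intervalIntegral.integral_zero.symm

lemma HasChordIntegral.unique {I' : ℝ} (h : HasChordIntegral Ω q x θ I)
    (h' : HasChordIntegral Ω q x θ I') : I = I' :=
  tendsto_nhds_unique h.2 h'.2

lemma HasChordIntegral.sub {I' : ℝ} (h₁ : HasChordIntegral Ω q₁ x θ I)
    (h₂ : HasChordIntegral Ω q₂ x θ I') (hbc : -exitDist Ω x (-θ) < exitDist Ω x θ) :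
    HasChordIntegral Ω (fun y => q₁ y - q₂ y) x θ (I - I') := by
  have e : (fun t : ℝ => Ω.indicator (fun y => q₁ y - q₂ y) (x + t • θ)) =
      fun t : ℝ => Ω.indicator q₁ (x + t • θ) - Ω.indicator q₂ (x + t • θ) := by
    ext t; exact congrFun (indicator_sub Ω q₁ q₂) _
  refine ⟨fun r hr s hs => ?_, ?_⟩
  · rw [e]; exact (h₁.1 r hr s hs).sub (h₂.1 r hr s hs)
  · refine (h₁.2.sub h₂.2).congr' ?_
    filter_upwards [eventually_mem_Ioo_prod hbc] with p hp
    have := intervalIntegral.integral_sub (h₁.1 _ hp.1 _ hp.2) (h₂.1 _ hp.1 _ hp.2)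
    rw [← this]
    exact congrArg (fun Q : ℝ → ℝ => ∫ t in p.1..p.2, Q t) e.symm

end chordIntegral

section direct
open MeasureTheory

variable {Ω : Set Plane} {a f : Plane → ℝ}

/-- The data are the chord integrals at the exit points, which are the points with `exitDist = 0`,
and zero at all other points, in particular at the entry points of nondegenerate chords. -/
lemma exists_isXRayData (ho : IsOpen Ω) (hb : Bornology.IsBounded Ω) (hc : Convex ℝ Ω)
    (hs : StrictConvex ℝ (closure Ω)) (hne : Ω.Nonempty) (ha : ContinuousOn a (closure Ω))
    (hf : ContinuousOn f (closure Ω)) : ∃ g : Plane → Plane → ℝ, IsXRayData Ω a f g := by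
  classical
  refine ⟨fun ζ θ => if exitDist Ω ζ θ = 0 then
    ∫ t in -exitDist Ω ζ (-θ)..0, f (ζ + t • θ) * Real.exp (-beam Ω a (ζ + t • θ) θ) else 0, ?_⟩
  intro x hx θ hθ
  have hθ' : ‖-θ‖ = 1 := by rwa [norm_neg]
  have hT := exitDist_nonneg hb hx hθ
  have hS := exitDist_nonneg hb hx hθ'
  have hle : -exitDist Ω x (-θ) ≤ exitDist Ω x θ := by linarith
  have hmem := mem_chord_iff ho hb hc hs hne hx hθ
  have hcont : ContinuousOn (fun t : ℝ => f (x + t • θ) * Real.exp (-beam Ω a (x + t • θ) θ))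
      (Icc (-exitDist Ω x (-θ)) (exitDist Ω x θ)) :=
    (continuousOn_chord hb hc hx hθ hf).mul (continuousOn_beam_chord hb hc hx hθ ha).neg.rexp
  have main := hasChordIntegral_of_continuousOn
    (q := fun y => f y * Real.exp (-beam Ω a y θ)) hmem hle hcont
  convert main using 1
  have e1 : exitDist Ω (exitPoint Ω x θ) θ = 0 := by
    rw [exitPoint, exitDist_add_smul hb hc hx hθ (right_mem_Icc.2 hle), sub_self]
  have e2 : exitDist Ω (exitPoint Ω x θ) (-θ) = exitDist Ω x (-θ) + exitDist Ω x θ :=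
    exitDist_add_smul_neg hb hc hx hθ (right_mem_Icc.2 hle)
  have e3 : entryPoint Ω x θ = x + (-exitDist Ω x (-θ)) • θ := by rw [entryPoint]; module
  have e5 : exitDist Ω (entryPoint Ω x θ) (-θ) = 0 := by
    rw [e3, exitDist_add_smul_neg hb hc hx hθ (left_mem_Icc.2 hle)]; ring
  beta_reduce
  rw [if_pos e1, e2]
  have hfirst : ∫ t in -(exitDist Ω x (-θ) + exitDist Ω x θ)..0,
      f (exitPoint Ω x θ + t • θ) * Real.exp (-beam Ω a (exitPoint Ω x θ + t • θ) θ) =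
      ∫ t in -exitDist Ω x (-θ)..exitDist Ω x θ,
        f (x + t • θ) * Real.exp (-beam Ω a (x + t • θ) θ) := by
    have e : ∀ t : ℝ, exitPoint Ω x θ + t • θ = x + (exitDist Ω x θ + t) • θ := fun t => by
      rw [exitPoint]; module
    simp only [e]
    rw [intervalIntegral.integral_comp_add_left
      (fun t => f (x + t • θ) * Real.exp (-beam Ω a (x + t • θ) θ))]
    congr 1 <;> ring
  rw [hfirst]
  by_cases h0 : exitDist Ω (entryPoint Ω x θ) θ = 0
  · rw [if_pos h0, e5, neg_zero, intervalIntegral.integral_same, mul_zero, sub_zero]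
  · rw [if_neg h0, mul_zero, sub_zero]

lemma inner_gradient_eq_fderiv {u : Plane → ℝ} (θ y : Plane) :
    inner ℝ θ (gradient u y) = fderiv ℝ u y θ := by
  rw [real_inner_comm, gradient, InnerProductSpace.toDual_symm_apply]

/-- With `u = f / a`, the two integrands differ by the derivative of `u * exp (-beam)` along the
chord, and `u` vanishes at the end points. -/
lemma isDopplerData_iff_isXRayData (ho : IsOpen Ω) (hb : Bornology.IsBounded Ω) (hc : Convex ℝ Ω)
    (hs : StrictConvex ℝ (closure Ω)) (hne : Ω.Nonempty) (ha1 : ContDiffOn ℝ 1 a Ω)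
    (ha : ContinuousOn a (closure Ω)) (hpos : ∀ x ∈ Ω, 0 < a x) (hf1 : ContDiffOn ℝ 1 f Ω)
    (hf : ContinuousOn f (closure Ω))
    (hlim : ∀ ζ ∈ frontier Ω, Tendsto (fun x => f x / a x) (𝓝[Ω] ζ) (𝓝 0))
    (g : Plane → Plane → ℝ) :
    IsDopplerData Ω a (fun x => -gradient (fun y => f y / a y) x) g ↔ IsXRayData Ω a f g := by
  set u : Plane → ℝ := fun y => f y / a y with hu
  have hu1 : ContDiffOn ℝ 1 u Ω := hf1.div ha1 fun x hx => (hpos x hx).ne'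
  have hud : ∀ y ∈ Ω, DifferentiableAt ℝ u y := fun y hy =>
    (hu1.differentiableOn one_ne_zero).differentiableAt (ho.mem_nhds hy)
  refine forall_congr' fun x => forall_congr' fun hx => forall_congr' fun θ =>
    forall_congr' fun hθ => ?_
  have hmem := mem_chord_iff ho hb hc hs hne hx hθ
  have hmemc := mem_closure_chord_iff hb hc hx hθ
  have hB := continuousOn_beam_chord hb hc hx hθ ha
  set b := -exitDist Ω x (-θ) with hbdef
  set c := exitDist Ω x θ with hcdef
  set E : ℝ → ℝ := fun t => Real.exp (-beam Ω a (x + t • θ) θ) with hE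
  have hEc : ContinuousOn E (Icc b c) := hB.neg.rexp
  have hEc' := hEc.mono (Ioo_subset_Icc_self)
  have hX : ContinuousOn (fun t : ℝ => f (x + t • θ) * E t) (Ioo b c) :=
    ((continuousOn_chord hb hc hx hθ hf).mono Ioo_subset_Icc_self).mul hEc'
  have hD : ContinuousOn (fun t : ℝ => inner ℝ θ (-gradient u (x + t • θ)) * E t) (Ioo b c) := by
    simp only [inner_neg_right, inner_gradient_eq_fderiv]
    have h1 : ContinuousOn (fderiv ℝ u) Ω := hu1.continuousOn_fderiv_of_isOpen ho le_rfl
    have h2 : ContinuousOn (fun t : ℝ => fderiv ℝ u (x + t • θ)) (Ioo b c) :=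
      h1.comp (by fun_prop) fun t ht => (hmem t).2 ht
    exact (h2.clm_apply continuousOn_const).neg.mul hEc'
  have hder : ∀ t ∈ Ioo b c, HasDerivAt (fun t : ℝ => u (x + t • θ) * E t)
      (f (x + t • θ) * E t - inner ℝ θ (-gradient u (x + t • θ)) * E t) t := by
    intro t ht
    have hy := (hmem t).2 ht
    have h1 : HasDerivAt (fun t : ℝ => x + t • θ) θ t := by
      simpa using ((hasDerivAt_id t).smul_const θ).const_add x
    have h2 := (hud _ hy).hasFDerivAt.comp_hasDerivAt t h1
    have h3 := (hasDerivAt_beam_chord hb hc hx hθ ha ht).neg.exp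
    refine (h2.mul h3).congr_deriv ?_
    rw [inner_neg_right, inner_gradient_eq_fderiv]
    have : u (x + t • θ) * a (x + t • θ) = f (x + t • θ) := div_mul_cancel₀ _ (hpos _ hy).ne'
    rw [← this]
    simp only [hE, Pi.neg_apply, Function.comp]
    ring
  have hcontline : Continuous fun t : ℝ => x + t • θ := by fun_prop
  have hend : ∀ s ∈ Icc b c, s ∉ Ioo b c → ∀ l : Filter ℝ, l ≤ 𝓝[Ioo b c] s →
      Tendsto (fun t : ℝ => u (x + t • θ) * E t) l (𝓝 0) := by
    intro s hs hs' l hl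
    have hfr : x + s • θ ∈ frontier Ω := by
      rw [frontier, ho.interior_eq]
      exact ⟨(hmemc s).2 hs, fun h => hs' ((hmem s).1 h)⟩
    have h1 : Tendsto (fun t : ℝ => x + t • θ) (𝓝[Ioo b c] s) (𝓝[Ω] (x + s • θ)) :=
      hcontline.continuousWithinAt.tendsto_nhdsWithin fun t ht => (hmem t).2 ht
    have h2 := ((hlim _ hfr).comp h1).mul
      ((hEc s hs).tendsto.mono_left (nhdsWithin_mono _ Ioo_subset_Icc_self))
    rw [zero_mul] at h2
    exact h2.mono_left hl
  have hl : b < c → Tendsto (fun t : ℝ => u (x + t • θ) * E t) (𝓝[>] b) (𝓝 0) := fun h =>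
    hend b (left_mem_Icc.2 h.le) (by simp) _ (by rw [nhdsWithin_Ioo_eq_nhdsGT h])
  have hr : b < c → Tendsto (fun t : ℝ => u (x + t • θ) * E t) (𝓝[<] c) (𝓝 0) := fun h =>
    hend c (right_mem_Icc.2 h.le) (by simp) _ (by rw [nhdsWithin_Ioo_eq_nhdsLT h])
  constructor
  · exact HasChordIntegral.of_hasDerivAt hmem hD hX hder hl hr
  · refine HasChordIntegral.of_hasDerivAt hmem hX hD (G := fun t => -(u (x + t • θ) * E t))
      (fun t ht => ?_) (fun h => by simpa using (hl h).neg) (fun h => by simpa using (hr h).neg)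
    exact (hder t ht).neg.congr_deriv (by ring)

end direct

/-! ### Extension by zero, and uniqueness -/

section extension
open MeasureTheory

variable {Ω : Set Plane}

lemma MemC1HolderZero.continuous_indicator {α : NNReal} {V : Type*} [NormedAddCommGroup V]
    [NormedSpace ℝ V] {u : Plane → V} (h : MemC1HolderZero Ω α u) : Continuous (Ω.indicator u) :=
  _root_.continuous_indicator h.2.2.2 h.2.1

lemma LipschitzOnWith.indicator_of_frontier {K : NNReal} {V : Type*} [NormedAddCommGroup V]
    {u : Plane → V} (ho : IsOpen Ω) (hu : LipschitzOnWith K u (closure Ω))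
    (h0 : ∀ x ∈ frontier Ω, u x = 0) : LipschitzWith K (Ω.indicator u) := by
  have hmix : ∀ x ∈ Ω, ∀ y ∉ Ω, dist (u x) 0 ≤ K * dist x y := by
    intro x hx y hy
    obtain ⟨z, hz, hzf⟩ : ∃ z ∈ segment ℝ x y, z ∈ frontier Ω := by
      by_contra! hcon
      have hcl : ∀ z ∈ segment ℝ x y, z ∉ Ω → z ∈ (closure Ω)ᶜ := fun z hz hzΩ hzc =>
        hcon z hz (by rw [frontier, ho.interior_eq]; exact ⟨hzc, hzΩ⟩)
      obtain ⟨z, -, hz1, hz2⟩ := (convex_segment (𝕜 := ℝ) x y).isPreconnected Ω (closure Ω)ᶜ ho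
        isClosed_closure.isOpen_compl (fun z hz => or_iff_not_imp_left.2 (hcl z hz))
        ⟨x, left_mem_segment ℝ x y, hx⟩
        ⟨y, right_mem_segment ℝ x y, hcl y (right_mem_segment ℝ x y) hy⟩
      exact hz2 (subset_closure hz1)
    have h1 := hu.dist_le_mul x (subset_closure hx) z (frontier_subset_closure hzf)
    rw [h0 z hzf] at h1
    have h2 := dist_add_dist_of_mem_segment hz
    refine h1.trans ?_
    gcongr
    linarith [dist_nonneg (x := z) (y := y)]
  refine LipschitzWith.of_dist_le_mul fun x y => ?_
  by_cases hx : x ∈ Ω <;> by_cases hy : y ∈ Ω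
  · rw [indicator_of_mem hx, indicator_of_mem hy]
    exact hu.dist_le_mul x (subset_closure hx) y (subset_closure hy)
  · rw [indicator_of_mem hx, indicator_of_notMem hy]; exact hmix x hx y hy
  · rw [indicator_of_notMem hx, indicator_of_mem hy, dist_comm, dist_comm x]; exact hmix y hy x hx
  · rw [indicator_of_notMem hx, indicator_of_notMem hy, dist_self]; positivity

/-- The extension by zero is Lipschitz: the derivative is bounded, being Hölder continuous on a
bounded set, and `Ω` is convex. -/
lemma MemC1HolderZero.exists_lipschitzWith {α : NNReal} {V : Type*} [NormedAddCommGroup V]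
    [NormedSpace ℝ V] {u : Plane → V} (h : MemC1HolderZero Ω α u) (ho : IsOpen Ω)
    (hb : Bornology.IsBounded Ω) (hc : Convex ℝ Ω) (hne : Ω.Nonempty) :
    ∃ K, LipschitzWith K (Ω.indicator u) := by
  obtain ⟨h1, h2, ⟨C, hC⟩, h4⟩ := h
  obtain ⟨x₀, hx₀⟩ := hne
  set K : ℝ := ‖fderiv ℝ u x₀‖ + C * Metric.diam Ω ^ (α : ℝ) with hK
  have hK0 : 0 ≤ K := by positivity
  have hbound : ∀ x ∈ Ω, ‖fderiv ℝ u x‖ ≤ K := by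
    intro x hx
    have e1 := hC.dist_le hx hx₀
    have e2 : dist x x₀ ^ (α : ℝ) ≤ Metric.diam Ω ^ (α : ℝ) :=
      Real.rpow_le_rpow dist_nonneg (Metric.dist_le_diam_of_mem hb hx hx₀) α.2
    have e3 := norm_le_norm_add_norm_sub' (fderiv ℝ u x) (fderiv ℝ u x₀)
    rw [dist_eq_norm] at e1
    have e4 : (C : ℝ) * dist x x₀ ^ (α : ℝ) ≤ C * Metric.diam Ω ^ (α : ℝ) := by gcongr
    linarith
  have hlip : LipschitzOnWith ⟨K, hK0⟩ u Ω :=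
    hc.lipschitzOnWith_of_nnnorm_fderiv_le
      (fun x hx => (h1.differentiableOn one_ne_zero).differentiableAt (ho.mem_nhds hx))
      (fun x hx => hbound x hx)
  exact ⟨_, (hlip.closure h2).indicator_of_frontier ho h4⟩

end extension

section transfer
open MeasureTheory ComplexConjugate

variable {Ω : Set Plane} {a f : Plane → ℝ} {F : Plane → Plane} {g : Plane → Plane → ℝ}

/-- The isometric identification of `ℂ` with the plane. -/
def complexPlane : ℂ ≃ₗᵢ[ℝ] Plane := Complex.orthonormalBasisOneI.repr

lemma beam_eq_integral_Ioi (ho : IsOpen Ω) (hb : Bornology.IsBounded Ω) (hc : Convex ℝ Ω)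
    (hs : StrictConvex ℝ (closure Ω)) (hne : Ω.Nonempty) (a : Plane → ℝ) {y θ : Plane}
    (hy : y ∈ closure Ω) (hθ : ‖θ‖ = 1) :
    beam Ω a y θ = ∫ s in Ioi (0 : ℝ), Ω.indicator a (y + s • θ) := by
  have hT := exitDist_nonneg hb hy hθ
  have hS := exitDist_nonneg hb hy (θ := -θ) (by rwa [norm_neg])
  rw [indicator_chord_eq (mem_chord_iff ho hb hc hs hne hy hθ),
    setIntegral_indicator measurableSet_Ioo,
    beam, intervalIntegral.integral_of_le hT, integral_Ioc_eq_integral_Ioo]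
  congr 2
  ext s
  simp only [mem_inter_iff, mem_Ioo, mem_Ioi]
  exact ⟨fun h => ⟨h.1, by linarith [h.1], h.2⟩, fun h => ⟨h.1, h.2.2⟩⟩

lemma sourceTerm_complexPlane (f : Plane → ℝ) (F : Plane → Plane) (z l : ℂ) :
    sourceTerm (fun z => f (complexPlane z)) (fun z => complexPlane.symm (F (complexPlane z))) z l
      = f (complexPlane z) - inner ℝ (complexPlane l) (F (complexPlane z)) := by
  rw [sourceTerm, mul_comm, ← Complex.inner]
  congr 1
  rw [← complexPlane.inner_map_map, LinearIsometryEquiv.apply_symm_apply]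

lemma integral_chord_eq_zero (ho : IsOpen Ω) (hb : Bornology.IsBounded Ω) (hc : Convex ℝ Ω)
    (hs : StrictConvex ℝ (closure Ω)) (hne : Ω.Nonempty) (ha : ContinuousOn a (closure Ω))
    (hf : ContinuousOn f (closure Ω)) (hF : ContinuousOn F (closure Ω))
    (hD : IsDopplerData Ω a F g) (hX : IsXRayData Ω a f g) {x θ : Plane} (hx : x ∈ Ω)
    (hθ : ‖θ‖ = 1) :
    ∫ t in -exitDist Ω x (-θ)..exitDist Ω x θ,
      (f (x + t • θ) - inner ℝ θ (F (x + t • θ))) * Real.exp (-beam Ω a (x + t • θ) θ) = 0 := by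
  have hxc := subset_closure hx
  have hmem := mem_chord_iff ho hb hc hs hne hxc hθ
  have h0 : (0 : ℝ) ∈ Ioo (-exitDist Ω x (-θ)) (exitDist Ω x θ) := (hmem 0).1 (by simpa using hx)
  have hlt := h0.1.trans h0.2
  have h1 := (hX x hxc θ hθ).sub (hD x hxc θ hθ) hlt
  rw [sub_self] at h1
  have h2 := hasChordIntegral_of_continuousOn hmem hlt.le
    (q := fun y => f y * Real.exp (-beam Ω a y θ) - inner ℝ θ (F y) * Real.exp (-beam Ω a y θ)) (by
      have hE := (continuousOn_beam_chord hb hc hxc hθ ha).neg.rexp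
      have hf' := continuousOn_chord hb hc hxc hθ hf
      have hF' := continuousOn_chord hb hc hxc hθ hF
      exact (hf'.mul hE).sub ((continuousOn_const.inner hF').mul hE))
  rw [h1.unique h2]
  congr 1; ext t; ring

/-- Common Doppler and X-ray data make the attenuated integral of `f - l · F` vanish on every line.
Along a line, `halfBeamDiff` and `-beam` differ by half the integral of `a` over the line, hence
the weights `exp (halfBeamDiff)` and `exp (-beam)` are proportional. -/
lemma integral_line_eq_zero {L : NNReal} {R : ℝ} (ho : IsOpen Ω) (hb : Bornology.IsBounded Ω)
    (hc : Convex ℝ Ω) (hs : StrictConvex ℝ (closure Ω)) (hne : Ω.Nonempty)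
    (hL : LipschitzWith L (Ω.indicator a)) (hR : ∀ y, R ≤ ‖y‖ → y ∉ Ω)
    (ha : ContinuousOn a (closure Ω))
    (hf : ContinuousOn f (closure Ω)) (hF : ContinuousOn F (closure Ω))
    (hD : IsDopplerData Ω a F g) (hX : IsXRayData Ω a f g) (z : ℂ) {l : ℂ} (hl : ‖l‖ = 1) :
    ∫ t : ℝ, sourceTerm (fun z => Ω.indicator f (complexPlane z))
      (fun z => complexPlane.symm (Ω.indicator F (complexPlane z))) (z + t * l) l *
      Real.exp (halfBeamDiff (fun z => Ω.indicator a (complexPlane z)) (z + t * l) l) = 0 := by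
  set A : ℂ → ℝ := fun z => Ω.indicator a (complexPlane z) with hA
  have hAc : Continuous A := hL.continuous.comp complexPlane.continuous
  have hAR : ∀ z, R ≤ ‖z‖ → A z = 0 := fun z hz =>
    indicator_of_notMem (hR _ (by rwa [LinearIsometryEquiv.norm_map])) _
  set θ := complexPlane l with hθdef
  have hθ : ‖θ‖ = 1 := by rw [hθdef, LinearIsometryEquiv.norm_map, hl]
  have hmap : ∀ (z : ℂ) (t : ℝ), complexPlane (z + t * l) = complexPlane z + t • θ := by
    intro z t
    rw [map_add, ← Complex.real_smul, map_smul]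
  set H : ℝ → ℝ := fun t => sourceTerm (fun z => Ω.indicator f (complexPlane z))
      (fun z => complexPlane.symm (Ω.indicator F (complexPlane z))) (z + t * l) l *
      Real.exp (halfBeamDiff A (z + t * l) l) with hH
  have hzero : ∀ t : ℝ, complexPlane (z + t * l) ∉ Ω → H t = 0 := by
    intro t ht
    simp only [hH]
    rw [sourceTerm_complexPlane, indicator_of_notMem ht, indicator_of_notMem ht]
    simp
  by_cases hex : ∃ t₀ : ℝ, complexPlane (z + t₀ * l) ∈ Ω
  swap
  · push Not at hex
    rw [integral_eq_zero_of_ae (Eventually.of_forall fun t => hzero t (hex t))]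
  obtain ⟨t₀, ht₀⟩ := hex
  set x := complexPlane (z + t₀ * l) with hx
  have hxt : ∀ t : ℝ, complexPlane (z + ((t + t₀ : ℝ) : ℂ) * l) = x + t • θ := by
    intro t
    rw [hx, hmap, hmap]; module
  have hxc := subset_closure ht₀
  have hmem := mem_chord_iff ho hb hc hs hne hxc hθ
  have hchord := integral_chord_eq_zero ho hb hc hs hne ha hf hF hD hX ht₀ hθ
  set b := -exitDist Ω x (-θ)
  set c := exitDist Ω x θ
  set P : ℝ := ∫ s : ℝ, A (z + s * l) with hP
  have hbeam : ∀ y : ℂ, complexPlane y ∈ Ω →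
      rayIntegral A y (-l) = beam Ω a (complexPlane y) θ := by
    intro y hy
    rw [beam_eq_integral_Ioi ho hb hc hs hne a (subset_closure hy) hθ, rayIntegral_neg]
    simp only [hA, hmap]
  have hhalf : ∀ t : ℝ, x + t • θ ∈ Ω →
      halfBeamDiff A (z + ((t + t₀ : ℝ) : ℂ) * l) l = P / 2 - beam Ω a (x + t • θ) θ := by
    intro t ht
    have h1 := rayIntegral_add_rayIntegral_neg hAc hAR hl (z + ((t + t₀ : ℝ) : ℂ) * l)
    have h2 : ∫ s : ℝ, A (z + ((t + t₀ : ℝ) : ℂ) * l + s * l) = P := by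
      rw [hP, ← integral_add_right_eq_self (fun s : ℝ => A (z + s * l)) (t + t₀)]
      congr 1; ext s
      congr 1; push_cast; ring
    have h3 := hbeam (z + ((t + t₀ : ℝ) : ℂ) * l) (by rwa [hxt])
    rw [hxt] at h3
    rw [halfBeamDiff, ← h3]
    linarith
  have hHt : ∀ t : ℝ, H (t + t₀) = (Ioo b c).indicator (fun t => (f (x + t • θ) -
      inner ℝ θ (F (x + t • θ))) * Real.exp (-beam Ω a (x + t • θ) θ)) t * Real.exp (P / 2) := by
    intro t
    by_cases ht : t ∈ Ioo b c
    · have hm := (hmem t).2 ht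
      rw [indicator_of_mem ht]
      simp only [hH]
      rw [hhalf t hm, sourceTerm_complexPlane, hxt, indicator_of_mem hm, indicator_of_mem hm,
        show P / 2 - beam Ω a (x + t • θ) θ = -beam Ω a (x + t • θ) θ + P / 2 by ring, Real.exp_add]
      ring
    · rw [indicator_of_notMem ht, zero_mul]
      exact hzero _ (by rw [hxt, hmem]; exact ht)
  have hlt : b ≤ c := by
    have h0 : (0 : ℝ) ∈ Ioo b c := (hmem 0).1 (by simpa using ht₀)
    exact (h0.1.trans h0.2).le
  rw [← integral_add_right_eq_self H t₀]
  simp only [hHt]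
  rw [integral_mul_const, integral_indicator measurableSet_Ioo, ← integral_Ioc_eq_integral_Ioo,
    ← intervalIntegral.integral_of_le hlt, hchord, zero_mul]

lemma gradient_div_eq_neg (ho : IsOpen Ω) (hb : Bornology.IsBounded Ω)
    (hc : Convex ℝ Ω) (hs : StrictConvex ℝ (closure Ω)) (hne : Ω.Nonempty) {α : NNReal}
    (ha : MemC1HolderZero Ω α a) (hpos : ∀ x ∈ Ω, 0 < a x) (hf : MemC1HolderZero Ω α f)
    (hF : MemC1HolderZero Ω α F) (hD : IsDopplerData Ω a F g) (hX : IsXRayData Ω a f g) :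
    ∀ x ∈ Ω, HasGradientAt (fun y => f y / a y) (-F x) x := by
  obtain ⟨L, hL⟩ := ha.exists_lipschitzWith ho hb hc hne
  obtain ⟨M, hM⟩ := hb.exists_norm_le
  have hR : ∀ y, M + 1 ≤ ‖y‖ → y ∉ Ω := fun y hy h => by linarith [hM y h]
  have hR' : ∀ z : ℂ, M + 1 ≤ ‖z‖ → complexPlane z ∉ Ω := fun z hz =>
    hR _ (by rwa [LinearIsometryEquiv.norm_map])
  have hLA : LipschitzWith L fun z => Ω.indicator a (complexPlane z) := by
    have := hL.comp complexPlane.lipschitz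
    rw [mul_one] at this
    exact this
  obtain ⟨p, hp0, hp⟩ := exists_potential (R := M + 1) hLA
    (fun z hz => indicator_of_notMem (hR' z hz) _)
    (hf.continuous_indicator.comp complexPlane.continuous)
    (complexPlane.symm.continuous.comp (hF.continuous_indicator.comp complexPlane.continuous))
    (fun z hz => indicator_of_notMem (hR' z hz) _)
    (fun z hz => by simp [indicator_of_notMem (hR' z hz)])
    (fun z l hl => integral_line_eq_zero ho hb hc hs hne hL hR ha.2.1 hf.2.1 hF.2.1 hD hX z hl)
  intro x hx
  have hdiff : DifferentiableAt ℝ (fun y => f y / a y) x :=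
    ((hf.1.div ha.1 fun y hy => (hpos y hy).ne').differentiableOn one_ne_zero).differentiableAt
      (ho.mem_nhds hx)
  have hpu : ∀ y ∈ Ω, p (complexPlane.symm y) = f y / a y := by
    intro y hy
    have := hp0 (complexPlane.symm y)
    simp only [Function.comp_apply, LinearIsometryEquiv.apply_symm_apply,
      indicator_of_mem hy] at this
    rw [this, mul_div_cancel_left₀ _ (hpos y hy).ne']
  have hunit : ∀ θ : Plane, ‖θ‖ = 1 → fderiv ℝ (fun y => f y / a y) x θ = inner ℝ (-F x) θ := by
    intro θ hθ
    have h1 := hp (complexPlane.symm x) (complexPlane.symm θ)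
      (by rw [LinearIsometryEquiv.norm_map, hθ])
    simp only [Function.comp, LinearIsometryEquiv.apply_symm_apply, indicator_of_mem hx] at h1
    rw [mul_comm, ← Complex.inner, complexPlane.symm.inner_map_map] at h1
    have hline : HasDerivAt (fun t : ℝ => x + t • θ) θ 0 := by
      simpa using ((hasDerivAt_id (0 : ℝ)).smul_const θ).const_add x
    have h2 : HasDerivAt (fun t : ℝ => f (x + t • θ) / a (x + t • θ))
        (fderiv ℝ (fun y => f y / a y) x θ) 0 :=
      HasFDerivAt.comp_hasDerivAt_of_eq (x := (0 : ℝ)) (l := fun y => f y / a y)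
        hdiff.hasFDerivAt hline (by simp)
    have hev : ∀ᶠ t : ℝ in 𝓝 0, x + t • θ ∈ Ω := by
      have hcont : Continuous fun t : ℝ => x + t • θ := by fun_prop
      exact hcont.continuousAt.eventually_mem (ho.mem_nhds (by simpa using hx))
    have h3 := h1.congr_of_eventuallyEq (f₁ := fun t : ℝ => f (x + t • θ) / a (x + t • θ)) (by
      filter_upwards [hev] with t ht
      rw [← hpu _ ht, map_add, map_smul, Complex.real_smul])
    rw [h2.unique h3, inner_neg_left, real_inner_comm]
  rw [hasGradientAt_iff_hasFDerivAt]
  refine hdiff.hasFDerivAt.congr_fderiv (ContinuousLinearMap.ext fun w => ?_)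
  rw [InnerProductSpace.toDual_apply_apply]
  rcases eq_or_ne w 0 with rfl | hw
  · simp
  have hw' : ‖w‖ ≠ 0 := norm_ne_zero_iff.2 hw
  have h := hunit (‖w‖⁻¹ • w) (by rw [norm_smul, norm_inv, norm_norm, inv_mul_cancel₀ hw'])
  rw [map_smul, inner_smul_right, smul_eq_mul] at h
  exact mul_left_cancel₀ (inv_ne_zero hw') h

end transfer

end

theorem theorem5p1 (Ω : Set Plane) (hΩ_open : IsOpen Ω) (hΩ_ne : Ω.Nonempty)
    (hΩ_bdd : Bornology.IsBounded Ω) (hΩ_conv : Convex ℝ Ω)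
    (hΩ_strict : StrictConvex ℝ (closure Ω)) :
    (∀ a f : Plane → ℝ,
      ContDiffOn ℝ 1 a Ω → ContinuousOn a (closure Ω) → (∀ x ∈ Ω, 0 < a x) →
      ContDiffOn ℝ 1 f Ω → ContinuousOn f (closure Ω) →
      (∀ ζ ∈ frontier Ω, Tendsto (fun x => f x / a x) (𝓝[Ω] ζ) (𝓝 0)) →
      (∃ g : Plane → Plane → ℝ, IsXRayData Ω a f g) ∧
      ∀ g : Plane → Plane → ℝ,
        IsDopplerData Ω a (fun x => -gradient (fun y => f y / a y) x) g ↔ IsXRayData Ω a f g) ∧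
    (∀ (α : NNReal) (a f : Plane → ℝ) (F : Plane → Plane) (g : Plane → Plane → ℝ),
      1 / 2 < α → α < 1 →
      MemC1HolderZero Ω α a → (∀ x ∈ Ω, 0 < a x) →
      MemC1HolderZero Ω α f → MemC1HolderZero Ω α F →
      IsDopplerData Ω a F g → IsXRayData Ω a f g →
      (∃ p : Plane → ℝ, ∀ x ∈ Ω, HasGradientAt p (F x) x) ∧
      ∀ x ∈ Ω, F x = -gradient (fun y => f y / a y) x) := by
  refine ⟨fun a f ha1 ha hpos hf1 hf hlim => ⟨?_, fun g => ?_⟩,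
    fun α a f F g _ _ ha hpos hf hF hD hX => ?_⟩
  · exact exists_isXRayData hΩ_open hΩ_bdd hΩ_conv hΩ_strict hΩ_ne ha hf
  · exact isDopplerData_iff_isXRayData hΩ_open hΩ_bdd hΩ_conv hΩ_strict hΩ_ne ha1 ha hpos hf1 hf
      hlim g
  · have h := gradient_div_eq_neg hΩ_open hΩ_bdd hΩ_conv hΩ_strict hΩ_ne ha hpos hf hF hD hX
    refine ⟨⟨fun y => -(f y / a y), fun x hx => ?_⟩, fun x hx => ?_⟩
    · have h1 := (h x hx).hasFDerivAt.neg
      rw [map_neg, neg_neg] at h1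
      exact h1
    · rw [(h x hx).gradient, neg_neg]
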